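/- Let $\mathbb D$ be the open unit disc, $\mathbb T$ the unit circle with normalized arc length measure, and $H^2$ the Hardy space of holomorphic functions $f$ on $\mathbb D$ with \[\|f\|_2^2=\sup_{0\le r<1}\int_0^{2\pi}|f(re^{i\theta})|^2\,\frac{d\theta}{2\pi}<\infty .\] For $\zeta\in\mathbb T$, $f(\zeta)=\lim_{r\to1^-}f(r\zeta)$ denotes the radial limit, which exists for almost every $\zeta$ when $f\in H^2$. Let $\varphi:\mathbb D\to\mathbb D$ be holomorphic and let $h\in H^2$. For a function $f$ on $\mathbb D$ put $(W_{h,\varphi}f)(z)=h(z)f(\varphi(z))$, and for $\delta>0$ put \[A_\delta=\{\zeta\in\mathbb T:\ |\varphi(\zeta)|\ge 1-\delta\}.\] (a) If for some $\delta>0$ and some constant $c_\delta>0$ we have $|h|\le c_\delta$ almost everywhere on $A_\delta$, then $W_{h,\varphi}$ maps $H^2$ into itself and is a bounded operator on $H^2$. (b) If for all sufficiently small $\delta>0$ there are constants $c_\delta>0$ with $|h|\le c_\delta$ almost everywhere on $A_\delta$, and $c_\delta\to0$ as $\delta\to0^+$, then $W_{h,\varphi}$ is a compact operator on $H^2$.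 -/

import Mathlib

open MeasureTheory Filter Topology Complex
open scoped ENNReal

noncomputable section

namespace HardyDisc

/-- A function on the open unit disc, extended by `0` to the whole plane. -/
def extend (f : UnitDisc → ℂ) (z : ℂ) : ℂ :=
  open Classical in if hz : ‖z‖ < 1 then f (UnitDisc.mk z hz) else 0

/-- Holomorphy of a function on the open unit disc. -/
def IsHolomorphic (f : UnitDisc → ℂ) : Prop :=
  DifferentiableOn ℂ (extend f) (Metric.ball 0 1)

/-- Normalized Lebesgue measure `dθ / 2π` on `(0, 2π]`. Through `θ ↦ circleMap 0 1 θ = exp (iθ)` it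
represents the normalized arc length measure on the unit circle. -/
def angleMeasure : Measure ℝ :=
  (ENNReal.ofReal (2 * Real.pi))⁻¹ • volume.restrict (Set.Ioc 0 (2 * Real.pi))

/-- The Hardy norm `(sup_{0 ≤ r < 1} ∫ |f (r exp (iθ))|² dθ / 2π) ^ (1/2)`, with values in `[0, ∞]`.
The number `circleMap 0 r θ` is `r * exp (iθ)`. -/
def hardyENorm (f : UnitDisc → ℂ) : ℝ≥0∞ :=
  ⨆ r ∈ Set.Ico (0 : ℝ) 1, eLpNorm (fun θ : ℝ => extend f (circleMap 0 r θ)) 2 angleMeasure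

/-- The radial limit of `f` at the point `ζ` of the unit circle. For functions in a Hardy space
it exists at almost every `ζ`; at the remaining points the value is of no significance. -/
def boundaryValue (f : UnitDisc → ℂ) (ζ : ℂ) : ℂ :=
  limUnder (𝓝[<] (1 : ℝ)) (fun r : ℝ => extend f (r * ζ))

theorem extend_coe (f : UnitDisc → ℂ) (z : UnitDisc) : extend f z = f z := by
  simp [extend, z.norm_lt_one]

theorem extend_zero : extend 0 = 0 := by
  funext z; simp [extend]

theorem extend_add (f g : UnitDisc → ℂ) : extend (f + g) = extend f + extend g := by
  funext z; by_cases hz : ‖z‖ < 1 <;> simp [extend, hz]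

theorem extend_smul (c : ℂ) (f : UnitDisc → ℂ) : extend (c • f) = c • extend f := by
  funext z; by_cases hz : ‖z‖ < 1 <;> simp [extend, hz]

theorem IsHolomorphic.continuous_circle {f : UnitDisc → ℂ} (hf : IsHolomorphic f) {r : ℝ}
    (hr : r ∈ Set.Ico (0 : ℝ) 1) : Continuous (fun θ : ℝ => extend f (circleMap 0 r θ)) := by
  refine hf.continuousOn.comp_continuous (continuous_circleMap 0 r) fun θ => ?_
  simpa [abs_of_nonneg hr.1] using hr.2

theorem IsHolomorphic.aesm_circle {f : UnitDisc → ℂ} (hf : IsHolomorphic f) {r : ℝ}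
    (hr : r ∈ Set.Ico (0 : ℝ) 1) :
    AEStronglyMeasurable (fun θ : ℝ => extend f (circleMap 0 r θ)) angleMeasure :=
  (hf.continuous_circle hr).aestronglyMeasurable

theorem isHolomorphic_zero : IsHolomorphic 0 := by
  rw [IsHolomorphic, extend_zero]; exact differentiableOn_const 0

theorem IsHolomorphic.add {f g : UnitDisc → ℂ} (hf : IsHolomorphic f) (hg : IsHolomorphic g) :
    IsHolomorphic (f + g) := by
  rw [IsHolomorphic, extend_add]; exact DifferentiableOn.add hf hg

theorem IsHolomorphic.smul (c : ℂ) {f : UnitDisc → ℂ} (hf : IsHolomorphic f) :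
    IsHolomorphic (c • f) := by
  rw [IsHolomorphic, extend_smul]; exact DifferentiableOn.const_smul hf c

theorem hardyENorm_zero : hardyENorm 0 = 0 := by
  simp [hardyENorm, extend_zero]

theorem hardyENorm_add_le {f g : UnitDisc → ℂ} (hf : IsHolomorphic f) (hg : IsHolomorphic g) :
    hardyENorm (f + g) ≤ hardyENorm f + hardyENorm g := by
  refine iSup₂_le fun r hr => ?_
  rw [extend_add]
  refine (eLpNorm_add_le (hf.aesm_circle hr) (hg.aesm_circle hr) (by norm_num)).trans ?_
  exact add_le_add
    (le_iSup₂ (f := fun (r : ℝ) (_ : r ∈ Set.Ico (0 : ℝ) 1) =>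
      eLpNorm (fun θ : ℝ => extend f (circleMap 0 r θ)) 2 angleMeasure) r hr)
    (le_iSup₂ (f := fun (r : ℝ) (_ : r ∈ Set.Ico (0 : ℝ) 1) =>
      eLpNorm (fun θ : ℝ => extend g (circleMap 0 r θ)) 2 angleMeasure) r hr)

theorem hardyENorm_smul (c : ℂ) (f : UnitDisc → ℂ) :
    hardyENorm (c • f) = ‖c‖ₑ * hardyENorm f := by
  simp only [hardyENorm, ENNReal.mul_iSup, extend_smul]
  refine iSup_congr fun r => iSup_congr fun _ => ?_
  exact eLpNorm_const_smul c (fun θ : ℝ => extend f (circleMap 0 r θ)) 2 angleMeasure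

theorem eq_zero_of_hardyENorm_eq_zero {f : UnitDisc → ℂ} (hf : IsHolomorphic f)
    (h0 : hardyENorm f = 0) : f = 0 := by
  funext z
  have hr : ‖(z : ℂ)‖ ∈ Set.Ico (0 : ℝ) 1 := ⟨norm_nonneg _, z.norm_lt_one⟩
  have h1 : eLpNorm (fun θ : ℝ => extend f (circleMap 0 ‖(z : ℂ)‖ θ)) 2 angleMeasure = 0 := by
    simp only [hardyENorm, ENNReal.iSup_eq_zero] at h0
    exact h0 _ hr
  rw [eLpNorm_eq_zero_iff (hf.aesm_circle hr) (by norm_num), angleMeasure] at h1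
  have hc : (ENNReal.ofReal (2 * Real.pi))⁻¹ ≠ 0 := by simp [ENNReal.mul_eq_top]
  have h2 := (Measure.ae_ennreal_smul_measure_iff hc).1 h1
  have h3 : Set.EqOn (fun θ : ℝ => extend f (circleMap 0 ‖(z : ℂ)‖ θ)) 0
      (Set.Ioc 0 (2 * Real.pi)) :=
    Measure.eqOn_Ioc_of_ae_eq volume h2 (hf.continuous_circle hr).continuousOn continuousOn_const
  obtain ⟨θ, hθ, he⟩ :=
    (periodic_circleMap 0 ‖(z : ℂ)‖).exists_mem_Ioc Real.two_pi_pos (arg z) 0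
  have h5 := h3 (by simpa using hθ)
  have h6 : circleMap 0 ‖(z : ℂ)‖ (arg z) = z := by simp [circleMap]
  simpa [← he, h6, extend_coe] using h5

/-- The linear space of holomorphic functions on the disc with finite Hardy norm. -/
def hardySubmodule : Submodule ℂ (UnitDisc → ℂ) where
  carrier := {f | IsHolomorphic f ∧ hardyENorm f < ∞}
  zero_mem' := ⟨isHolomorphic_zero, by simp [hardyENorm_zero]⟩
  add_mem' hf hg := ⟨hf.1.add hg.1,
    (hardyENorm_add_le hf.1 hg.1).trans_lt (ENNReal.add_lt_top.2 ⟨hf.2, hg.2⟩)⟩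
  smul_mem' c _ hf := ⟨hf.1.smul c, by
    rw [hardyENorm_smul]; exact ENNReal.mul_lt_top enorm_lt_top hf.2⟩

/-- The Hardy space `H²` of the unit disc. It is a separate type, so that its topology is the one
of the Hardy norm and not that of pointwise convergence. -/
def HardyTwo : Type := hardySubmodule

namespace HardyTwo

instance : AddCommGroup HardyTwo := inferInstanceAs (AddCommGroup hardySubmodule)

instance : Module ℂ HardyTwo := inferInstanceAs (Module ℂ hardySubmodule)

instance : CoeFun HardyTwo (fun _ => UnitDisc → ℂ) := ⟨fun f => f.1⟩

instance : Norm HardyTwo := ⟨fun f => (hardyENorm f).toReal⟩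

theorem normedSpaceCore : NormedSpace.Core ℂ HardyTwo where
  norm_nonneg _ := ENNReal.toReal_nonneg
  norm_smul c f := by
    change (hardyENorm (c • f.1)).toReal = ‖c‖ * (hardyENorm f.1).toReal
    simp [hardyENorm_smul]
  norm_triangle f g := by
    change (hardyENorm (f.1 + g.1)).toReal ≤ (hardyENorm f.1).toReal + (hardyENorm g.1).toReal
    rw [← ENNReal.toReal_add f.2.2.ne g.2.2.ne]
    exact ENNReal.toReal_mono (ENNReal.add_lt_top.2 ⟨f.2.2, g.2.2⟩).ne
      (hardyENorm_add_le f.2.1 g.2.1)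
  norm_eq_zero_iff f := by
    change (hardyENorm f.1).toReal = 0 ↔ f = 0
    rw [ENNReal.toReal_eq_zero_iff, or_iff_left f.2.2.ne]
    constructor
    · exact fun h => Subtype.ext (eq_zero_of_hardyENorm_eq_zero f.2.1 h)
    · rintro rfl
      exact hardyENorm_zero

instance : NormedAddCommGroup HardyTwo := NormedAddCommGroup.ofCore normedSpaceCore

instance : NormedSpace ℂ HardyTwo := NormedSpace.ofCore normedSpaceCore

end HardyTwo

/-- The function `W_{h,φ} f = h · (f ∘ φ)`. -/
def weightedComposition (h : UnitDisc → ℂ) (φ : UnitDisc → UnitDisc) (f : UnitDisc → ℂ) :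
    UnitDisc → ℂ :=
  fun z => h z * f (φ z)

/-- `W_{h,φ}` maps `H²` into itself and is a bounded operator there. -/
def IsBoundedOnHardyTwo (h : UnitDisc → ℂ) (φ : UnitDisc → UnitDisc) : Prop :=
  ∃ T : HardyTwo →L[ℂ] HardyTwo, ∀ f : HardyTwo, (T f : UnitDisc → ℂ) = weightedComposition h φ f

/-- `W_{h,φ}` maps `H²` into itself and is a compact operator there. -/
def IsCompactOnHardyTwo (h : UnitDisc → ℂ) (φ : UnitDisc → UnitDisc) : Prop :=
  ∃ T : HardyTwo →L[ℂ] HardyTwo,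
    (∀ f : HardyTwo, (T f : UnitDisc → ℂ) = weightedComposition h φ f) ∧ IsCompactOperator T

/-- The set `A_δ` of the points `ζ` of the unit circle with `|φ(ζ)| ≥ 1 - δ`, where `φ(ζ)` is the
radial limit. -/
def contactSet (φ : UnitDisc → UnitDisc) (δ : ℝ) : Set ℂ :=
  {ζ | ‖ζ‖ = 1 ∧ 1 - δ ≤ ‖boundaryValue (fun z => (φ z : ℂ)) ζ‖}

/-- `|h| ≤ c` almost everywhere on the subset `A` of the unit circle. -/
def AEBoundedOn (h : UnitDisc → ℂ) (A : Set ℂ) (c : ℝ) : Prop :=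
  ∀ᵐ θ ∂angleMeasure, circleMap 0 1 θ ∈ A → ‖boundaryValue h (circleMap 0 1 θ)‖ ≤ c

end HardyDisc

end

namespace HardyDisc

/-! On the circle, `W f` has boundary values `h · (f ∘ φ)`, and the circle is split along `A_δ`. On
`A_δ` the weight is at most `c`, so this part costs `c ‖f ∘ φ‖ ≤ c C ‖f‖` by Littlewood
subordination. Off `A_δ` the limit of `φ` has modulus below `1 - δ`, so `f ∘ φ` is at most the
supremum `S` of `|f|` on that smaller disc, and this part costs `S ‖h‖`. If the first `N` Taylor
coefficients of `f` vanish, then `S ≤ ‖f‖ ρ ^ N / (1 - ρ)` whenever `max (1 - δ) 0 ≤ ρ < 1`.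

Taking `N = 0` gives (a). For (b), a small `δ` makes `c C` small and then a large `N` makes the
other term small. So `W` is the norm limit of its compositions with Taylor truncations, which have
finite rank.

The norm of `W f` can be read off its boundary values only once `W f` is known to lie in `H²`. The
splitting (`hardyENorm_weightedComposition_le`) is therefore applied to polynomials, whose images
are `h` times a bounded function, and Fatou's lemma passes to general `f`
(`hardyENorm_weightedComposition_taylorSum_le`).

The boundary theory rests on the isometry of `H²` with `ℓ²`, Poisson's formula, and Fatou's theorem
on radial limits (`ae_tendsto_radial`). -/

/-! ### Approximate identities at Lebesgue points of the line. -/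

theorem lintegral_Ioi_deriv_of_nonneg {g g' : ℝ → ℝ} {a l : ℝ}
    (hderiv : ∀ x ∈ Set.Ici a, HasDerivAt g (g' x) x) (hpos : ∀ x ∈ Set.Ioi a, 0 ≤ g' x)
    (hg : Tendsto g atTop (𝓝 l)) :
    ∫⁻ x in Set.Ioi a, ENNReal.ofReal (g' x) = ENNReal.ofReal (l - g a) := by
  have hint := integrableOn_Ioi_deriv_of_nonneg' hderiv hpos hg
  rw [← integral_Ioi_of_hasDerivAt_of_tendsto' hderiv hint hg,
    ofReal_integral_eq_lintegral_ofReal hint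
      ((ae_restrict_iff' measurableSet_Ioi).2 (Eventually.of_forall hpos))]

theorem lintegral_Ioi_div_add_sq {a u : ℝ} (ha : 0 < a) (hu : 0 ≤ u) :
    ∫⁻ s in Set.Ioi u, ENNReal.ofReal (a / (a + s) ^ 2) = ENNReal.ofReal (a / (a + u)) := by
  rw [lintegral_Ioi_deriv_of_nonneg (g := fun s => -(a / (a + s))) (l := 0)]
  · simp
  · intro x hx
    have hx' : a + x ≠ 0 := (add_pos_of_pos_of_nonneg ha (hu.trans hx)).ne'
    have h := (((hasDerivAt_id x).const_add a).inv hx').const_mul (-a)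
    refine (h.congr_deriv ?_).congr_of_eventuallyEq (Eventually.of_forall fun y => ?_)
    · simp only [id]; ring
    · simp [div_eq_mul_inv]
  · intro x hx
    positivity
  · have : Tendsto (fun s : ℝ => a / (a + s)) atTop (𝓝 0) :=
      tendsto_const_nhds.div_atTop (tendsto_atTop_add_const_left _ a tendsto_id)
    simpa using this.neg

theorem lintegral_Ioi_div_add_cube {a u : ℝ} (ha : 0 < a) (hu : 0 ≤ u) :
    ∫⁻ s in Set.Ioi u, ENNReal.ofReal (2 * a / (a + s) ^ 3) =
      ENNReal.ofReal (a / (a + u) ^ 2) := by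
  rw [lintegral_Ioi_deriv_of_nonneg (g := fun s => -(a / (a + s) ^ 2)) (l := 0)]
  · simp
  · intro x hx
    have hx' : a + x ≠ 0 := (add_pos_of_pos_of_nonneg ha (hu.trans hx)).ne'
    have h := ((((hasDerivAt_id x).const_add a).pow 2).inv (pow_ne_zero 2 hx')).const_mul (-a)
    refine (h.congr_deriv ?_).congr_of_eventuallyEq (Eventually.of_forall fun y => ?_)
    · simp only [id, Pi.pow_apply]; field_simp; norm_num; ring
    · simp [div_eq_mul_inv]
  · intro x hx
    have hx' : 0 < x := hu.trans_lt hx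
    positivity
  · have : Tendsto (fun s : ℝ => a / (a + s) ^ 2) atTop (𝓝 0) :=
      tendsto_const_nhds.div_atTop
        ((tendsto_pow_atTop two_ne_zero).comp (tendsto_atTop_add_const_left _ a tendsto_id))
    simpa using this.neg

/-- Layer cake representation of an integral against the kernel `a / (a + |t - x|) ^ 2`. -/
theorem lintegral_kernel_eq {k : ℝ → ℝ≥0∞} (hk : Measurable k) {a x : ℝ} (ha : 0 < a) :
    ∫⁻ t, ENNReal.ofReal (a / (a + |t - x|) ^ 2) * k t =
      ∫⁻ s in Set.Ioi 0, ENNReal.ofReal (2 * a / (a + s) ^ 3) * ∫⁻ t in Metric.ball x s, k t := by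
  have h1 : ∀ t, ENNReal.ofReal (a / (a + |t - x|) ^ 2) * k t =
      ∫⁻ s in Set.Ioi 0, {p : ℝ × ℝ | |p.1 - x| < p.2}.indicator
        (fun p => ENNReal.ofReal (2 * a / (a + p.2) ^ 3) * k p.1) (t, s) := by
    intro t
    rw [← lintegral_Ioi_div_add_cube ha (abs_nonneg _), ← lintegral_mul_const _ (by fun_prop),
      ← lintegral_indicator measurableSet_Ioi, ← lintegral_indicator measurableSet_Ioi]
    congr 1 with s
    by_cases hs : |t - x| < s
    · have : 0 < s := (abs_nonneg _).trans_lt hs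
      simp [Set.indicator, hs, this]
    · simp [Set.indicator, hs]
  have hset : MeasurableSet {p : ℝ × ℝ | |p.1 - x| < p.2} :=
    measurableSet_lt (by fun_prop) (by fun_prop)
  simp_rw [h1]
  rw [lintegral_lintegral_swap]
  · refine lintegral_congr fun s => ?_
    rw [← lintegral_const_mul _ hk, ← lintegral_indicator Metric.isOpen_ball.measurableSet]
    congr 1 with t
  · exact (Measurable.indicator (by fun_prop) hset).aemeasurable

/-- Split the layer cake integral at `s = η`. Below `η` the integrand is at most `2τ · a / (a + s) ^
2`, of total mass `2τ`; above `η` the balls have mass at most `M`, and the remaining weight is `a /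
(a + η) ^ 2`. -/
theorem lintegral_kernel_le {k : ℝ → ℝ≥0∞} (hk : Measurable k) {a x τ η : ℝ} {M : ℝ≥0∞}
    (ha : 0 < a) (hτ : 0 ≤ τ) (hη : 0 < η)
    (hsmall : ∀ s, 0 < s → s ≤ η → ∫⁻ t in Metric.ball x s, k t ≤ ENNReal.ofReal (τ * s))
    (hM : ∫⁻ t, k t ≤ M) :
    ∫⁻ t, ENNReal.ofReal (a / (a + |t - x|) ^ 2) * k t ≤
      ENNReal.ofReal (2 * τ) + ENNReal.ofReal (a / η ^ 2) * M := by
  rw [lintegral_kernel_eq hk ha]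
  have hbound : ∀ s ∈ Set.Ioi (0 : ℝ),
      ENNReal.ofReal (2 * a / (a + s) ^ 3) * ∫⁻ t in Metric.ball x s, k t ≤
        ENNReal.ofReal (2 * τ) * ENNReal.ofReal (a / (a + s) ^ 2) +
        (Set.Ioi η).indicator (fun s => ENNReal.ofReal (2 * a / (a + s) ^ 3)) s * M := by
    intro s hs
    have hs0 : 0 < s := hs
    by_cases h : s ≤ η
    · refine le_add_right ((mul_le_mul_right (hsmall s hs h) _).trans ?_)
      rw [← ENNReal.ofReal_mul (by positivity), ← ENNReal.ofReal_mul (by positivity)]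
      refine ENNReal.ofReal_le_ofReal ?_
      have e1 : 2 * a / (a + s) ^ 3 * (τ * s) = 2 * τ * (a / (a + s) ^ 2) * (s / (a + s)) := by
        field_simp
      rw [e1]
      refine mul_le_of_le_one_right (by positivity) ?_
      rw [div_le_one (by positivity)]
      linarith
    · refine le_add_left ?_
      rw [Set.indicator_of_mem (by simpa using h)]
      gcongr
      exact (setLIntegral_le_lintegral _ _).trans hM
  refine (setLIntegral_mono' measurableSet_Ioi hbound).trans ?_
  rw [lintegral_add_left (by fun_prop), lintegral_const_mul _ (by fun_prop),
    lintegral_Ioi_div_add_sq ha le_rfl,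
    lintegral_mul_const _ (Measurable.indicator (by fun_prop) measurableSet_Ioi)]
  gcongr
  · simp [ha.ne']
  · rw [lintegral_indicator measurableSet_Ioi, Measure.restrict_restrict measurableSet_Ioi,
      Set.inter_eq_left.2 (Set.Ioi_subset_Ioi hη.le), lintegral_Ioi_div_add_cube ha hη.le]
    refine ENNReal.ofReal_le_ofReal ?_
    gcongr
    linarith

theorem tendsto_lintegral_kernel {k : ℝ → ℝ≥0∞} (hk : Measurable k) {x : ℝ}
    (hint : ∫⁻ t, k t ≠ ∞)
    (hsmall : ∀ τ : ℝ, 0 < τ → ∀ᶠ s in 𝓝[>] (0 : ℝ),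
      ∫⁻ t in Metric.ball x s, k t ≤ ENNReal.ofReal (τ * s)) :
    Tendsto (fun a => ∫⁻ t, ENNReal.ofReal (a / (a + |t - x|) ^ 2) * k t) (𝓝[>] (0 : ℝ))
      (𝓝 0) := by
  rw [ENNReal.tendsto_nhds_zero]
  intro ε hε
  by_cases hε' : ε = ∞
  · simp [hε']
  have hε0 : 0 < ε.toReal := ENNReal.toReal_pos hε.ne' hε'
  -- With `τ = ε / 4` the near part costs `ε / 2`; the far part tends to `0` with `a`, since `η` is
  -- now fixed.
  obtain ⟨η, hη, hη'⟩ := mem_nhdsGT_iff_exists_Ioc_subset.1 (hsmall (ε.toReal / 4) (by positivity))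
  have hη0 : 0 < η := hη
  have hlim : Tendsto (fun a : ℝ => ENNReal.ofReal (a / η ^ 2) * ∫⁻ t, k t) (𝓝[>] 0) (𝓝 0) := by
    have h1 : Tendsto (fun a : ℝ => ENNReal.ofReal (a / η ^ 2)) (𝓝[>] 0) (𝓝 0) := by
      have : Continuous (fun a : ℝ => ENNReal.ofReal (a / η ^ 2)) :=
        ENNReal.continuous_ofReal.comp (by fun_prop)
      simpa using (this.tendsto 0).mono_left nhdsWithin_le_nhds
    simpa using ENNReal.Tendsto.mul_const h1 (Or.inr hint)
  have hε2 : 0 < ENNReal.ofReal (ε.toReal / 2) := by simpa using hε0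
  filter_upwards [self_mem_nhdsWithin, hlim.eventually_le_const hε2] with a ha ha2
  refine (lintegral_kernel_le hk ha (by positivity) hη0
    (fun s hs hsη => hη' ⟨hs, hsη⟩) le_rfl).trans ((add_le_add_right ha2 _).trans ?_)
  rw [← ENNReal.ofReal_add (by positivity) (by positivity)]
  refine (ENNReal.ofReal_le_ofReal (by linarith)).trans (ENNReal.ofReal_toReal hε').le

/-- At almost every point of a bounded interval, an integrable function is approximated by its
averages against the kernels `a / (a + |t - x|) ^ 2`. -/
theorem ae_tendsto_lintegral_kernel {f : ℝ → ℂ} {S : Set ℝ} (hS : MeasurableSet S)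
    (hSfin : volume S ≠ ∞) (hfm : Measurable f) (hf : Integrable f) :
    ∀ᵐ x, Tendsto (fun a => ∫⁻ t in S, ENNReal.ofReal (a / (a + |t - x|) ^ 2) * ‖f t - f x‖ₑ)
      (𝓝[>] (0 : ℝ)) (𝓝 0) := by
  filter_upwards [IsUnifLocDoublingMeasure.ae_tendsto_average_norm_sub volume
    hf.locallyIntegrable 1] with x hx
  have hlim := hx (l := 𝓝[>] (0 : ℝ)) (fun _ => x) id tendsto_id (by
    filter_upwards [self_mem_nhdsWithin] with s hs
    exact Metric.mem_closedBall_self (by simpa using le_of_lt hs))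
  have hk : Measurable (S.indicator fun t => ‖f t - f x‖ₑ) :=
    Measurable.indicator (by fun_prop) hS
  have := tendsto_lintegral_kernel hk (x := x) ?_ ?_
  · refine this.congr fun a => ?_
    rw [← lintegral_indicator hS]
    congr 1 with t
    by_cases ht : t ∈ S <;> simp [ht]
  · rw [lintegral_indicator hS]
    have : IntegrableOn (fun t => f t - f x) S :=
      hf.integrableOn.sub (integrableOn_const hSfin)
    exact this.2.ne
  · intro τ hτ
    -- The ball has length `2 * s`, so an average of at most `τ / 2` means an integral of at most `τ
    -- * s`.
    filter_upwards [self_mem_nhdsWithin, hlim.eventually_le_const (half_pos hτ)] with s hs hs2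
    have hs0 : 0 < s := hs
    have hint : IntegrableOn (fun t => f t - f x) (Metric.closedBall x s) :=
      hf.integrableOn.sub (integrableOn_const measure_closedBall_lt_top.ne)
    rw [setAverage_eq] at hs2
    simp only [id, Real.volume_real_closedBall hs0.le, smul_eq_mul] at hs2
    rw [inv_mul_le_iff₀ (by positivity)] at hs2
    calc ∫⁻ t in Metric.ball x s, S.indicator (fun t => ‖f t - f x‖ₑ) t
        ≤ ∫⁻ t in Metric.ball x s, ‖f t - f x‖ₑ :=
          lintegral_mono fun t => Set.indicator_le_self _ _ _
      _ ≤ ∫⁻ t in Metric.closedBall x s, ‖f t - f x‖ₑ :=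
          lintegral_mono_set Metric.ball_subset_closedBall
      _ = ENNReal.ofReal (∫ t in Metric.closedBall x s, ‖f t - f x‖) :=
          (ofReal_integral_norm_eq_lintegral_enorm hint).symm
      _ ≤ ENNReal.ofReal (τ * s) := ENNReal.ofReal_le_ofReal (by linarith)

/-! ### Normalized measure and Fourier series on the circle. -/

instance isProbabilityMeasure_angleMeasure : IsProbabilityMeasure angleMeasure := by
  constructor
  have h : ENNReal.ofReal (2 * Real.pi) ≠ 0 := by simpa using Real.pi_pos
  simp only [angleMeasure, Measure.smul_apply, Measure.restrict_apply_univ, Real.volume_Ioc,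
    sub_zero, smul_eq_mul]
  exact ENNReal.inv_mul_cancel h ENNReal.ofReal_ne_top

theorem integral_angleMeasure {E : Type*} [NormedAddCommGroup E] [NormedSpace ℝ E] (f : ℝ → E) :
    ∫ θ, f θ ∂angleMeasure = (2 * Real.pi)⁻¹ • ∫ θ in (0 : ℝ)..2 * Real.pi, f θ := by
  rw [angleMeasure, integral_smul_measure, intervalIntegral.integral_of_le Real.two_pi_pos.le,
    ENNReal.toReal_inv, ENNReal.toReal_ofReal Real.two_pi_pos.le]

theorem integral_circleMap_angleMeasure {E : Type*} [NormedAddCommGroup E] [NormedSpace ℝ E]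
    (f : ℂ → E) (r : ℝ) :
    ∫ θ, f (circleMap 0 r θ) ∂angleMeasure = Real.circleAverage f 0 r :=
  integral_angleMeasure _

theorem ae_angleMeasure_iff {p : ℝ → Prop} :
    (∀ᵐ θ ∂angleMeasure, p θ) ↔ ∀ᵐ θ ∂volume.restrict (Set.Ioc 0 (2 * Real.pi)), p θ :=
  Measure.ae_ennreal_smul_measure_iff (by simp [ENNReal.mul_eq_top])

theorem memLp_comp_circleMap {f : ℝ → ℂ} (hf : Continuous f) {C : ℝ} (hC : ∀ θ, ‖f θ‖ ≤ C)
    (p : ℝ≥0∞) : MemLp f p angleMeasure :=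
  MemLp.of_bound hf.aestronglyMeasurable C (Eventually.of_forall hC)

theorem continuous_circleMap_pow (r : ℝ) (n : ℕ) : Continuous fun θ => circleMap 0 r θ ^ n :=
  (continuous_circleMap 0 r).pow n

/-- The function `θ ↦ exp (i n θ)` as an element of `L²`. -/
noncomputable def expLp (n : ℕ) : Lp ℂ 2 angleMeasure :=
  (memLp_comp_circleMap (continuous_circleMap_pow 1 n) (C := 1) (by simp) 2).toLp _

theorem coeFn_expLp (n : ℕ) : expLp n =ᵐ[angleMeasure] fun θ => circleMap 0 1 θ ^ n :=
  MemLp.coeFn_toLp _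

theorem integral_circleMap_pow {n : ℕ} (hn : n ≠ 0) :
    ∫ θ, circleMap 0 1 θ ^ n ∂angleMeasure = 0 := by
  rw [integral_circleMap_angleMeasure (fun z => z ^ n),
    DiffContOnCl.circleAverage (Differentiable.diffContOnCl (by fun_prop))]
  simp [hn]

theorem integral_circleMap_pow_mul_conj {m n : ℕ} (hmn : m < n) :
    ∫ θ, circleMap 0 1 θ ^ n * (starRingEnd ℂ) (circleMap 0 1 θ ^ m) ∂angleMeasure = 0 := by
  refine Eq.trans (integral_congr_ae (Eventually.of_forall fun θ => ?_))
    (integral_circleMap_pow (Nat.sub_ne_zero_of_lt hmn))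
  beta_reduce
  have h1 : circleMap 0 1 θ * (starRingEnd ℂ) (circleMap 0 1 θ) = 1 := by
    rw [Complex.mul_conj']; simp
  obtain ⟨k, rfl⟩ := Nat.exists_eq_add_of_lt hmn
  rw [map_pow, show m + k + 1 - m = k + 1 by omega, show m + k + 1 = (k + 1) + m by omega, pow_add,
    mul_assoc, ← mul_pow, h1, one_pow, mul_one]

theorem orthonormal_expLp : Orthonormal ℂ expLp := by
  have hinner : ∀ m n, inner ℂ (expLp m) (expLp n) =
      ∫ θ, circleMap 0 1 θ ^ n * (starRingEnd ℂ) (circleMap 0 1 θ ^ m) ∂angleMeasure := by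
    intro m n
    rw [L2.inner_def]
    refine integral_congr_ae ?_
    filter_upwards [coeFn_expLp m, coeFn_expLp n] with θ h1 h2
    rw [h1, h2, RCLike.inner_apply]
  have hlt : ∀ m n, m < n → inner ℂ (expLp m) (expLp n) = 0 := fun m n h => by
    rw [hinner, integral_circleMap_pow_mul_conj h]
  rw [orthonormal_iff_ite]
  intro m n
  rcases lt_trichotomy m n with h | rfl | h
  · rw [hlt m n h, if_neg h.ne]
  · rw [hinner, if_pos rfl]
    simp only [Complex.mul_conj']; simp
  · rw [← inner_conj_symm, hlt n m h, if_neg h.ne', map_zero]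

/-- Square summable sequences of Taylor coefficients. -/
abbrev Coeffs : Type := lp (fun _ : ℕ => ℂ) 2

/-- The isometry `a ↦ ∑ a n * exp (i n θ)` of `ℓ²` into `L²`. -/
noncomputable def fourierIsometry : Coeffs →ₗᵢ[ℂ] Lp ℂ 2 angleMeasure :=
  orthonormal_expLp.orthogonalFamily.linearIsometry

theorem hasSum_fourierIsometry (a : Coeffs) :
    HasSum (fun n => a n • expLp n) (fourierIsometry a) :=
  orthonormal_expLp.orthogonalFamily.hasSum_linearIsometry a

/-- The partial sums converge in `L²`, hence almost everywhere along a subsequence, and there the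
limit can only be the pointwise sum. -/
theorem fourierIsometry_ae_eq {a : Coeffs} {F : ℝ → ℂ}
    (hF : ∀ θ, HasSum (fun n => a n * circleMap 0 1 θ ^ n) (F θ)) :
    fourierIsometry a =ᵐ[angleMeasure] F := by
  obtain ⟨ns, hns, hlim⟩ := (tendstoInMeasure_of_tendsto_Lp
    (hasSum_fourierIsometry a).tendsto_sum_nat).exists_seq_tendsto_ae
  have hsum : ∀ᵐ θ ∂angleMeasure, ∀ N : ℕ, (∑ n ∈ Finset.range N, a n • expLp n : Lp ℂ 2 _) θ =
      ∑ n ∈ Finset.range N, a n * circleMap 0 1 θ ^ n := by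
    rw [ae_all_iff]
    intro N
    have h1 : ∀ᵐ θ ∂angleMeasure, ∀ n, (a n • expLp n : Lp ℂ 2 _) θ = a n * circleMap 0 1 θ ^ n := by
      rw [ae_all_iff]
      intro n
      filter_upwards [Lp.coeFn_smul (a n) (expLp n), coeFn_expLp n] with θ h1 h2
      rw [h1, Pi.smul_apply, h2, smul_eq_mul]
    filter_upwards [Lp.coeFn_finsetSum (Finset.range N) (fun n => a n • expLp n), h1] with θ h2 h3
    rw [h2, Finset.sum_apply]
    exact Finset.sum_congr rfl fun n _ => h3 n
  filter_upwards [hlim, hsum] with θ h1 h2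
  simp only [h2] at h1
  exact tendsto_nhds_unique h1 ((hF θ).tendsto_sum_nat.comp hns.tendsto_atTop)

/-! ### Power series and the identification of `H²` with `ℓ²`. -/

theorem norm_sq_eq_tsum (a : Coeffs) : HasSum (fun n => ‖a n‖ ^ 2) (‖a‖ ^ 2) := by
  simpa only [ENNReal.toReal_ofNat, Real.rpow_ofNat] using lp.hasSum_norm (p := 2) (by simp) a

theorem norm_coeff_le (a : Coeffs) (n : ℕ) : ‖a n‖ ≤ ‖a‖ :=
  lp.norm_apply_le_norm two_ne_zero a n

theorem summable_coeff_mul_pow (a : Coeffs) {w : ℂ} (hw : ‖w‖ < 1) :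
    Summable fun n => a n * w ^ n := by
  refine Summable.of_norm_bounded ((summable_geometric_of_lt_one (norm_nonneg w) hw).mul_left ‖a‖)
    fun n => ?_
  rw [norm_mul, norm_pow]
  gcongr
  exact norm_coeff_le a n

/-- The function on the disc with Taylor coefficients `a`. -/
noncomputable def taylorSum (a : Coeffs) : UnitDisc → ℂ := fun z => ∑' n, a n * (z : ℂ) ^ n

theorem extend_taylorSum (a : Coeffs) {w : ℂ} (hw : ‖w‖ < 1) :
    extend (taylorSum a) w = ∑' n, a n * w ^ n := by
  simp [extend, taylorSum, hw]

theorem hasSum_taylorSum (a : Coeffs) {w : ℂ} (hw : ‖w‖ < 1) :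
    HasSum (fun n => a n * w ^ n) (extend (taylorSum a) w) := by
  rw [extend_taylorSum a hw]
  exact (summable_coeff_mul_pow a hw).hasSum

theorem isHolomorphic_taylorSum (a : Coeffs) : IsHolomorphic (taylorSum a) := by
  intro z hz
  rw [mem_ball_zero_iff] at hz
  obtain ⟨r, hr1, hr2⟩ := exists_between hz
  have hr0 : 0 ≤ r := (norm_nonneg z).trans hr1.le
  have h : DifferentiableOn ℂ (fun w => ∑' n, a n * w ^ n) (Metric.ball 0 r) := by
    refine differentiableOn_tsum_of_summable_norm
      ((summable_geometric_of_lt_one hr0 hr2).mul_left ‖a‖) (fun n => by fun_prop)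
      Metric.isOpen_ball fun n w hw => ?_
    rw [mem_ball_zero_iff] at hw
    rw [norm_mul, norm_pow]
    gcongr
    exact norm_coeff_le a n
  have hmem : Metric.ball (0 : ℂ) r ∈ 𝓝 z := Metric.isOpen_ball.mem_nhds (by simpa using hr1)
  refine ((h.differentiableAt hmem).congr_of_eventuallyEq ?_).differentiableWithinAt
  filter_upwards [hmem] with w hw
  exact extend_taylorSum a ((mem_ball_zero_iff.1 hw).trans hr2)

/-- Parseval's identity on circles. -/
theorem eLpNorm_circle_eq {f : UnitDisc → ℂ} {b : Coeffs} {r : ℝ}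
    (hf : ∀ θ, HasSum (fun n => b n * circleMap 0 1 θ ^ n) (extend f (circleMap 0 r θ))) :
    eLpNorm (fun θ => extend f (circleMap 0 r θ)) 2 angleMeasure = ENNReal.ofReal ‖b‖ := by
  rw [← eLpNorm_congr_ae (fourierIsometry_ae_eq hf), ← fourierIsometry.norm_map b, Lp.norm_def,
    ENNReal.ofReal_toReal (Lp.eLpNorm_ne_top _)]

theorem circleMap_zero_eq (r θ : ℝ) : circleMap 0 r θ = r * circleMap 0 1 θ := by
  simp [circleMap]

theorem memlp_two_iff {a : ℕ → ℂ} : Memℓp a 2 ↔ Summable fun n => ‖a n‖ ^ 2 := by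
  simp only [memℓp_gen_iff (p := 2) (by simp), ENNReal.toReal_ofNat, Real.rpow_ofNat]

theorem exists_eLpNorm_circle_eq {f : UnitDisc → ℂ} {a : ℕ → ℂ}
    (hf : ∀ w : ℂ, ‖w‖ < 1 → HasSum (fun n => a n * w ^ n) (extend f w)) {r : ℝ}
    (hr : r ∈ Set.Ico (0 : ℝ) 1) :
    ∃ b : Coeffs, (∀ n, b n = a n * r ^ n) ∧
      eLpNorm (fun θ => extend f (circleMap 0 r θ)) 2 angleMeasure = ENNReal.ofReal ‖b‖ := by
  -- Convergence at an intermediate radius `s` bounds `a n * s ^ n`, so `a n * r ^ n` decays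
  -- geometrically and is square summable.
  obtain ⟨s, hs1, hs2⟩ := exists_between hr.2
  have hs0 : 0 < s := hr.1.trans_lt hs1
  have h1 := (hf s (by simpa [abs_of_pos hs0] using hs2)).summable.tendsto_atTop_zero
  obtain ⟨C, hC⟩ := h1.norm.bddAbove_range
  have hmem : Memℓp (fun n => a n * (r : ℂ) ^ n) 2 := by
    rw [memlp_two_iff]
    have hq : r / s < 1 := (div_lt_one hs0).2 hs1
    have hq0 : 0 ≤ r / s := div_nonneg hr.1 hs0.le
    refine Summable.of_nonneg_of_le (fun n => by positivity) (fun n => ?_)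
      ((summable_geometric_of_lt_one (sq_nonneg _) (pow_lt_one₀ hq0 hq two_ne_zero)).mul_left
        (C ^ 2))
    have h2 : ‖a n * (s : ℂ) ^ n‖ ≤ C := hC ⟨n, rfl⟩
    have h3 : ‖a n * (r : ℂ) ^ n‖ = ‖a n * (s : ℂ) ^ n‖ * (r / s) ^ n := by
      simp only [norm_mul, norm_pow, norm_real, Real.norm_eq_abs, abs_of_pos hs0, abs_of_nonneg hr.1]
      rw [mul_assoc, ← mul_pow, mul_div_cancel₀ r hs0.ne']
    rw [h3, mul_pow, ← pow_mul, ← pow_mul, mul_comm n 2]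
    gcongr
  refine ⟨⟨_, hmem⟩, fun n => rfl, eLpNorm_circle_eq fun θ => ?_⟩
  have := hf (circleMap 0 r θ) (by simpa [abs_of_nonneg hr.1] using hr.2)
  simpa only [circleMap_zero_eq r, mul_pow, ← mul_assoc] using this

theorem eLpNorm_circle_le_hardyENorm (f : UnitDisc → ℂ) {r : ℝ} (hr : r ∈ Set.Ico (0 : ℝ) 1) :
    eLpNorm (fun θ => extend f (circleMap 0 r θ)) 2 angleMeasure ≤ hardyENorm f :=
  le_iSup₂ (f := fun (r : ℝ) (_ : r ∈ Set.Ico (0 : ℝ) 1) =>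
    eLpNorm (fun θ : ℝ => extend f (circleMap 0 r θ)) 2 angleMeasure) r hr

/-- Parseval on the circle of radius `r` bounds the sum weighted by `r ^ (2 * n)`; a finite sum
allows `r → 1`. -/
theorem sum_sq_coeff_le {f : UnitDisc → ℂ} {a : ℕ → ℂ}
    (hf : ∀ w : ℂ, ‖w‖ < 1 → HasSum (fun n => a n * w ^ n) (extend f w))
    (hfin : hardyENorm f < ∞) (N : ℕ) :
    ∑ n ∈ Finset.range N, ‖a n‖ ^ 2 ≤ (hardyENorm f).toReal ^ 2 := by
  have hle : ∀ r ∈ Set.Ico (0 : ℝ) 1,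
      ∑ n ∈ Finset.range N, (‖a n‖ * r ^ n) ^ 2 ≤ (hardyENorm f).toReal ^ 2 := by
    intro r hr
    obtain ⟨b, hb, he⟩ := exists_eLpNorm_circle_eq hf hr
    have h1 : ‖b‖ ≤ (hardyENorm f).toReal := by
      rw [← ENNReal.ofReal_le_iff_le_toReal hfin.ne, ← he]
      exact eLpNorm_circle_le_hardyENorm f hr
    refine le_trans ?_ (pow_le_pow_left₀ (norm_nonneg b) h1 2)
    have h2 := sum_le_hasSum (Finset.range N) (fun n _ => by positivity) (norm_sq_eq_tsum b)
    simpa [hb, abs_of_nonneg hr.1] using h2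
  have hcont : Continuous fun r : ℝ => ∑ n ∈ Finset.range N, (‖a n‖ * r ^ n) ^ 2 := by fun_prop
  have hlim := (hcont.tendsto 1).mono_left (nhdsWithin_le_nhds (s := Set.Iio 1))
  simp only [one_pow, mul_one] at hlim
  refine le_of_tendsto hlim ?_
  filter_upwards [Ioo_mem_nhdsLT (zero_lt_one' ℝ)] with r hr
  exact hle r ⟨hr.1.le, hr.2⟩

theorem hardyENorm_taylorSum (a : Coeffs) : hardyENorm (taylorSum a) = ENNReal.ofReal ‖a‖ := by
  have hle : hardyENorm (taylorSum a) ≤ ENNReal.ofReal ‖a‖ := by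
    refine iSup₂_le fun r hr => ?_
    obtain ⟨b, hb, he⟩ := exists_eLpNorm_circle_eq (fun w hw => hasSum_taylorSum a hw) hr
    rw [he]
    refine ENNReal.ofReal_le_ofReal ?_
    refine (sq_le_sq₀ (norm_nonneg _) (norm_nonneg _)).1 ?_
    refine hasSum_le (fun n => ?_) (norm_sq_eq_tsum b) (norm_sq_eq_tsum a)
    rw [hb]
    gcongr
    simp only [norm_mul, norm_pow, norm_real, Real.norm_eq_abs, abs_of_nonneg hr.1]
    exact mul_le_of_le_one_right (norm_nonneg _) (pow_le_one₀ hr.1 hr.2.le)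
  refine le_antisymm hle ?_
  have hfin : hardyENorm (taylorSum a) < ∞ := hle.trans_lt ENNReal.ofReal_lt_top
  rw [ENNReal.ofReal_le_iff_le_toReal hfin.ne]
  refine (sq_le_sq₀ (norm_nonneg _) ENNReal.toReal_nonneg).1 ?_
  exact le_of_tendsto (norm_sq_eq_tsum a).tendsto_sum_nat
    (Eventually.of_forall (sum_sq_coeff_le (fun w hw => hasSum_taylorSum a hw) hfin))

theorem exists_eq_taylorSum {f : UnitDisc → ℂ} (hf : IsHolomorphic f) (hfin : hardyENorm f < ∞) :
    ∃ a : Coeffs, f = taylorSum a := by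
  have hsum : ∀ w : ℂ, ‖w‖ < 1 → HasSum
      (fun n => ((n.factorial : ℂ)⁻¹ * iteratedDeriv n (extend f) 0) * w ^ n) (extend f w) := by
    intro w hw
    have := Complex.hasSum_taylorSeries_on_ball hf (mem_ball_zero_iff.2 hw)
    convert! this using 1
    funext n
    rw [smul_eq_mul, smul_eq_mul, sub_zero]
    ring
  have hmem : Memℓp (fun n => (n.factorial : ℂ)⁻¹ * iteratedDeriv n (extend f) 0) 2 :=
    memlp_two_iff.2 (summable_of_sum_range_le (fun n => by positivity)
      (sum_sq_coeff_le hsum hfin))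
  refine ⟨⟨_, hmem⟩, funext fun z => ?_⟩
  have h1 := hsum z z.norm_lt_one
  rw [extend_coe] at h1
  exact h1.tsum_eq.symm

theorem taylorSum_add (a b : Coeffs) : taylorSum (a + b) = taylorSum a + taylorSum b := by
  funext z
  simp only [taylorSum, lp.coeFn_add, Pi.add_apply, add_mul]
  exact (summable_coeff_mul_pow a z.norm_lt_one).tsum_add (summable_coeff_mul_pow b z.norm_lt_one)

theorem taylorSum_smul (c : ℂ) (a : Coeffs) : taylorSum (c • a) = c • taylorSum a := by
  funext z
  simp only [taylorSum, lp.coeFn_smul, Pi.smul_apply, smul_eq_mul, mul_assoc, tsum_mul_left]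

namespace HardyTwo

/-- The isometric isomorphism of `ℓ²` onto `H²` given by power series. -/
noncomputable def ofCoeffs : Coeffs ≃ₗᵢ[ℂ] HardyTwo :=
  LinearIsometryEquiv.ofSurjective
    { toFun := fun a => ⟨taylorSum a, isHolomorphic_taylorSum a, by
        rw [hardyENorm_taylorSum]; exact ENNReal.ofReal_lt_top⟩
      map_add' := fun a b => Subtype.ext (taylorSum_add a b)
      map_smul' := fun c a => Subtype.ext (taylorSum_smul c a)
      norm_map' := fun a => by
        change (hardyENorm (taylorSum a)).toReal = _
        rw [hardyENorm_taylorSum, ENNReal.toReal_ofReal (norm_nonneg a)] }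
    (fun f => by
      obtain ⟨a, ha⟩ := exists_eq_taylorSum f.2.1 f.2.2
      exact ⟨a, Subtype.ext ha.symm⟩)

theorem coe_ofCoeffs (a : Coeffs) : (ofCoeffs a : UnitDisc → ℂ) = taylorSum a := rfl

/-- Completeness of the target makes norm limits of compact operators compact. -/
instance : CompleteSpace HardyTwo := 
  (completeSpace_congr (e := ofCoeffs.toEquiv) ofCoeffs.isometry.isUniformEmbedding).1 inferInstance

end HardyTwo

/-! ### The Poisson kernel and Poisson's formula. -/

theorem circleMap_sub_ne_zero {w : ℂ} (hw : ‖w‖ < 1) (θ : ℝ) : circleMap 0 1 θ - w ≠ 0 := by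
  intro h
  have : ‖circleMap 0 1 θ‖ = 1 := by simp
  rw [sub_eq_zero.1 h] at this
  exact hw.ne this

theorem poissonKernel_circleMap (w : ℂ) (θ : ℝ) :
    poissonKernel 0 w (circleMap 0 1 θ) = (1 - ‖w‖ ^ 2) / ‖circleMap 0 1 θ - w‖ ^ 2 := by
  simp [poissonKernel_def]

theorem continuous_poissonKernel_circleMap {w : ℂ} (hw : ‖w‖ < 1) :
    Continuous fun θ => poissonKernel 0 w (circleMap 0 1 θ) := by
  simp only [poissonKernel_circleMap]
  refine Continuous.div (by fun_prop) ?_ fun θ =>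
    pow_ne_zero 2 (norm_ne_zero_iff.2 (circleMap_sub_ne_zero hw θ))
  exact (((continuous_circleMap 0 1).sub continuous_const).norm).pow 2

theorem poissonKernel_circleMap_nonneg {w : ℂ} (hw : ‖w‖ < 1) (θ : ℝ) :
    0 ≤ poissonKernel 0 w (circleMap 0 1 θ) := by
  rw [poissonKernel_circleMap]
  have : ‖w‖ ^ 2 ≤ 1 := pow_le_one₀ (norm_nonneg w) hw.le
  exact div_nonneg (by linarith) (by positivity)

theorem poissonKernel_circleMap_le {w : ℂ} (hw : ‖w‖ < 1) (θ : ℝ) :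
    poissonKernel 0 w (circleMap 0 1 θ) ≤ (1 + ‖w‖) / (1 - ‖w‖) := by
  rw [poissonKernel_eq_re_herglotzRieszKernel]
  simpa [herglotzRieszKernel_def] using re_herglotzRieszKernel_le (c := 0) (R := 1) (w := w)
    (z := circleMap 0 1 θ) (by simp) (by simpa using hw)

theorem memLp_poissonKernel {w : ℂ} (hw : ‖w‖ < 1) :
    MemLp (fun θ => (poissonKernel 0 w (circleMap 0 1 θ) : ℂ)) 2 angleMeasure := by
  refine memLp_comp_circleMap (continuous_ofReal.comp (continuous_poissonKernel_circleMap hw))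
    (C := (1 + ‖w‖) / (1 - ‖w‖)) (fun θ => ?_) 2
  rw [Function.comp_apply, norm_real, Real.norm_of_nonneg (poissonKernel_circleMap_nonneg hw θ)]
  exact poissonKernel_circleMap_le hw θ

theorem integral_poissonKernel_smul {f : ℂ → ℂ} (hf : Differentiable ℂ f) {w : ℂ} (hw : ‖w‖ < 1) :
    ∫ θ, poissonKernel 0 w (circleMap 0 1 θ) • f (circleMap 0 1 θ) ∂angleMeasure = f w := by
  rw [← DiffContOnCl.circleAverage_poissonKernel_smul (hf.diffContOnCl (s := Metric.ball 0 1))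
    (mem_ball_zero_iff.2 hw), ← integral_circleMap_angleMeasure]
  rfl

/-- Written as an inner product, the Poisson integral is continuous on `L²` and can be applied to a
Fourier series term by term. -/
theorem inner_poissonKernel_toLp {w : ℂ} (hw : ‖w‖ < 1) {g : Lp ℂ 2 angleMeasure} {G : ℝ → ℂ}
    (hg : g =ᵐ[angleMeasure] G) :
    inner ℂ ((memLp_poissonKernel hw).toLp _) g =
      ∫ θ, poissonKernel 0 w (circleMap 0 1 θ) • G θ ∂angleMeasure := by
  rw [L2.inner_def]
  refine integral_congr_ae ?_
  filter_upwards [(memLp_poissonKernel hw).coeFn_toLp, hg] with θ h1 h2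
  rw [h1, h2, RCLike.inner_apply, Complex.conj_ofReal, mul_comm, Complex.real_smul]

/-- Poisson's formula for functions in `H²`. -/
theorem extend_taylorSum_eq_integral (a : Coeffs) {w : ℂ} (hw : ‖w‖ < 1) :
    extend (taylorSum a) w =
      ∫ θ, poissonKernel 0 w (circleMap 0 1 θ) • fourierIsometry a θ ∂angleMeasure := by
  rw [← inner_poissonKernel_toLp hw EventuallyEq.rfl]
  refine (hasSum_taylorSum a hw).unique ?_
  convert! (hasSum_fourierIsometry a).mapL (innerSL ℂ ((memLp_poissonKernel hw).toLp _)) using 1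
  funext n
  rw [innerSL_apply_apply, inner_smul_right, inner_poissonKernel_toLp hw (coeFn_expLp n),
    integral_poissonKernel_smul (f := fun z => z ^ n) (by fun_prop) hw]

theorem lintegral_poissonKernel {w : ℂ} (hw : ‖w‖ < 1) :
    ∫⁻ θ, ENNReal.ofReal (poissonKernel 0 w (circleMap 0 1 θ)) ∂angleMeasure = 1 := by
  have hcont := continuous_poissonKernel_circleMap hw
  have hint : Integrable (fun θ => poissonKernel 0 w (circleMap 0 1 θ)) angleMeasure := by
    refine (MemLp.of_bound (p := 1) hcont.aestronglyMeasurable ((1 + ‖w‖) / (1 - ‖w‖))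
      (Eventually.of_forall fun θ => ?_)).integrable le_rfl
    rw [Real.norm_of_nonneg (poissonKernel_circleMap_nonneg hw θ)]
    exact poissonKernel_circleMap_le hw θ
  have h := integral_poissonKernel_smul (f := fun _ => 1) (by fun_prop) hw
  simp only [Complex.real_smul, mul_one] at h
  have h1 : ∫ θ, poissonKernel 0 w (circleMap 0 1 θ) ∂angleMeasure = 1 :=
    Complex.ofReal_eq_one.1 (integral_ofReal.symm.trans h)
  rw [← ofReal_integral_eq_lintegral_ofReal hint
    (Eventually.of_forall (poissonKernel_circleMap_nonneg hw)), h1]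
  simp

theorem enorm_smul_poissonKernel {w : ℂ} (hw : ‖w‖ < 1) (θ : ℝ) (c : ℂ) :
    ‖poissonKernel 0 w (circleMap 0 1 θ) • c‖ₑ =
      ENNReal.ofReal (poissonKernel 0 w (circleMap 0 1 θ)) * ‖c‖ₑ := by
  rw [enorm_smul, Real.enorm_of_nonneg (poissonKernel_circleMap_nonneg hw θ)]

/-! ### Radial limits -/

/-- The difference quotient is continuous on a compact interval and vanishes nowhere: at `x` it is
the derivative, and elsewhere `exp (it) = exp (ix)` is impossible because `x` is an interior point.
Its minimum modulus is the constant. -/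
theorem exists_mul_le_norm_circleMap_sub {x : ℝ} (hx : x ∈ Set.Ioo 0 (2 * Real.pi)) :
    ∃ c > 0, ∀ t ∈ Set.Icc 0 (2 * Real.pi),
      c * |t - x| ≤ ‖circleMap 0 1 t - circleMap 0 1 x‖ := by
  have hd : Continuous (dslope (circleMap 0 1) x) := by
    rw [continuous_iff_continuousAt]
    intro t
    by_cases h : t = x
    · rw [h, continuousAt_dslope_same]
      exact (differentiable_circleMap 0 1) x
    · rw [continuousAt_dslope_of_ne h]
      exact (continuous_circleMap 0 1).continuousAt
  obtain ⟨t₀, ht₀, hmin⟩ := isCompact_Icc.exists_isMinOn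
    (Set.nonempty_Icc.2 Real.two_pi_pos.le) hd.norm.continuousOn
  have hmul : ∀ t, ‖circleMap 0 1 t - circleMap 0 1 x‖ =
      ‖dslope (circleMap 0 1) x t‖ * |t - x| := by
    intro t
    rw [← sub_smul_dslope (circleMap 0 1) x t, norm_smul, Real.norm_eq_abs, mul_comm]
  refine ⟨‖dslope (circleMap 0 1) x t₀‖, ?_, fun t ht => ?_⟩
  · rw [gt_iff_lt, norm_pos_iff]
    by_cases h : t₀ = x
    · rw [h, dslope_same, deriv_circleMap]
      simp
    · intro h0
      have h1 := hmul t₀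
      rw [h0, norm_zero, zero_mul, norm_eq_zero, sub_eq_zero,
        circleMap_eq_circleMap_iff 0 one_ne_zero] at h1
      obtain ⟨n, hn⟩ := h1
      have h2 : t₀ = x + n * (2 * Real.pi) := by
        have h3 : (t₀ : ℂ) * I = ((x + n * (2 * Real.pi) : ℝ) : ℂ) * I := by
          rw [hn]; push_cast; ring
        exact_mod_cast mul_right_cancel₀ I_ne_zero h3
      have hn0 : n ≠ 0 := by rintro rfl; exact h (by simpa using h2)
      have hlt : |(n : ℝ)| * (2 * Real.pi) < 1 * (2 * Real.pi) := by
        rw [one_mul, ← abs_of_pos Real.two_pi_pos, ← abs_mul, abs_of_pos Real.two_pi_pos, abs_lt]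
        exact ⟨by linarith [ht₀.1, hx.2], by linarith [ht₀.2, hx.1]⟩
      have := lt_of_mul_lt_mul_right hlt Real.two_pi_pos.le
      rw [← Int.cast_abs] at this
      have h4 : |n| < 1 := by exact_mod_cast this
      exact hn0 (Int.abs_lt_one_iff.1 h4)
  · rw [hmul t]
    exact mul_le_mul_of_nonneg_right (hmin ht) (abs_nonneg _)

theorem exists_poissonKernel_le {x : ℝ} (hx : x ∈ Set.Ioo 0 (2 * Real.pi)) :
    ∃ C : ℝ, 0 < C ∧ ∀ r ∈ Set.Ico (0 : ℝ) 1, ∀ t ∈ Set.Icc 0 (2 * Real.pi),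
      poissonKernel 0 (circleMap 0 r x) (circleMap 0 1 t) ≤
        C * ((1 - r) / ((1 - r) + |t - x|) ^ 2) := by
  obtain ⟨c, hc, hle⟩ := exists_mul_le_norm_circleMap_sub hx
  set c' := min c 1 with hc'
  have hc'0 : 0 < c' := lt_min hc one_pos
  -- Here `18 = 2 * 3 ^ 2`: the numerator satisfies `1 - r ^ 2 ≤ 2 * (1 - r)`, and the denominator
  -- `D ^ 2` is controlled by `h3`.
  refine ⟨18 / c' ^ 2, by positivity, fun r hr t ht => ?_⟩
  have hr1 : 0 < 1 - r := sub_pos.2 hr.2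
  have hnr : ‖circleMap 0 r x‖ = r := by simp [abs_of_nonneg hr.1]
  have hxr : ‖circleMap 0 1 x - circleMap 0 r x‖ = 1 - r := by
    rw [circleMap_zero_eq r x, ← one_sub_mul, norm_mul, ← ofReal_one, ← ofReal_sub, norm_real,
      Real.norm_of_nonneg hr1.le]
    simp
  set D := ‖circleMap 0 1 t - circleMap 0 r x‖ with hD
  have h1 : 1 - r ≤ D := by
    have := norm_sub_norm_le (circleMap 0 1 t) (circleMap 0 r x)
    rw [hnr] at this
    simpa using this
  have h2 : c * |t - x| ≤ D + (1 - r) := by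
    refine (hle t ht).trans ?_
    have := norm_sub_le_norm_sub_add_norm_sub (circleMap 0 1 t) (circleMap 0 r x) (circleMap 0 1 x)
    rwa [norm_sub_rev (circleMap 0 r x), hxr] at this
  have h3 : c' * ((1 - r) + |t - x|) ≤ 3 * D := by
    have e1 : c' * (1 - r) ≤ 1 * (1 - r) := by gcongr; exact min_le_right _ _
    have e2 : c' * |t - x| ≤ c * |t - x| := by gcongr; exact min_le_left _ _
    linarith
  have hpos : 0 < (1 - r) + |t - x| := add_pos_of_pos_of_nonneg hr1 (abs_nonneg _)
  rw [poissonKernel_circleMap, hnr, div_le_iff₀ (pow_pos (hr1.trans_le h1) 2)]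
  have h4 : (c' * ((1 - r) + |t - x|)) ^ 2 ≤ (3 * D) ^ 2 := by gcongr
  have h5 : 18 / c' ^ 2 * ((1 - r) / (1 - r + |t - x|) ^ 2) * D ^ 2 =
      2 * (1 - r) * ((3 * D) ^ 2 / (c' * ((1 - r) + |t - x|)) ^ 2) := by
    field_simp; ring
  rw [h5]
  have h6 : 1 ≤ (3 * D) ^ 2 / (c' * ((1 - r) + |t - x|)) ^ 2 :=
    (one_le_div (by positivity)).2 h4
  calc 1 - r ^ 2 = (1 + r) * (1 - r) := by ring
    _ ≤ 2 * (1 - r) := by gcongr; linarith [hr.2]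
    _ ≤ _ := le_mul_of_one_le_right (by positivity) h6

theorem integrable_angleMeasure_iff {f : ℝ → ℂ} :
    Integrable f angleMeasure ↔ IntegrableOn f (Set.Ioc 0 (2 * Real.pi)) :=
  integrable_smul_measure (by simp [ENNReal.mul_eq_top]) (by simpa using Real.pi_pos)

theorem lintegral_angleMeasure (f : ℝ → ℝ≥0∞) :
    ∫⁻ θ, f θ ∂angleMeasure =
      (ENNReal.ofReal (2 * Real.pi))⁻¹ * ∫⁻ θ in Set.Ioc 0 (2 * Real.pi), f θ :=
  lintegral_smul_measure _ _

theorem integrable_poissonKernel_smul (g : Lp ℂ 2 angleMeasure) {w : ℂ} (hw : ‖w‖ < 1) :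
    Integrable (fun θ => poissonKernel 0 w (circleMap 0 1 θ) • g θ) angleMeasure := by
  simp only [Complex.real_smul]
  exact (memLp_poissonKernel hw).integrable_mul (Lp.memLp g)

/-- The constant `c` is its own Poisson integral, so it can be subtracted under the integral sign.
-/
theorem enorm_extend_taylorSum_sub_le (a : Coeffs) (c : ℂ) {w : ℂ} (hw : ‖w‖ < 1) :
    ‖extend (taylorSum a) w - c‖ₑ ≤ ∫⁻ θ, ENNReal.ofReal (poissonKernel 0 w (circleMap 0 1 θ)) *
      ‖fourierIsometry a θ - c‖ₑ ∂angleMeasure := by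
  have hconst := integral_poissonKernel_smul (f := fun _ => c) (by fun_prop) hw
  have hint : Integrable (fun θ => poissonKernel 0 w (circleMap 0 1 θ) • c) angleMeasure := by
    simp only [Complex.real_smul]
    exact ((memLp_poissonKernel hw).integrable one_le_two).mul_const c
  have hdiff : extend (taylorSum a) w - c =
      ∫ θ, (poissonKernel 0 w (circleMap 0 1 θ) • fourierIsometry a θ -
        poissonKernel 0 w (circleMap 0 1 θ) • c) ∂angleMeasure := by
    rw [integral_sub (integrable_poissonKernel_smul _ hw) hint, hconst,
      extend_taylorSum_eq_integral a hw]
  rw [hdiff]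
  refine (enorm_integral_le_lintegral_enorm _).trans (lintegral_mono fun θ => ?_)
  rw [← smul_sub, enorm_smul_poissonKernel hw]

/-- Fatou's theorem: functions in `H²` have radial limits almost everywhere. -/
theorem ae_tendsto_radial (a : Coeffs) :
    ∀ᵐ x ∂angleMeasure, Tendsto (fun r : ℝ => extend (taylorSum a) (r * circleMap 0 1 x))
      (𝓝[<] 1) (𝓝 (fourierIsometry a x)) := by
  set G := fourierIsometry a with hG
  set S := Set.Ioc 0 (2 * Real.pi)
  have hGm : Measurable G := (Lp.stronglyMeasurable G).measurable
  have hctop : (ENNReal.ofReal (2 * Real.pi))⁻¹ ≠ ∞ := by simpa using Real.pi_pos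
  have hGint : IntegrableOn G S := by
    exact integrable_angleMeasure_iff.1 ((Lp.memLp G).integrable one_le_two)
  have hleb := ae_tendsto_lintegral_kernel (S := S) measurableSet_Ioc (by simp [S, ENNReal.mul_eq_top])
    (hGm.indicator measurableSet_Ioc) (hGint.integrable_indicator measurableSet_Ioc)
  -- The endpoint is a null set; dropping it puts `x` in the open interval required by the kernel
  -- bound.
  rw [ae_angleMeasure_iff, ← restrict_Ioo_eq_restrict_Ioc, ae_restrict_iff' measurableSet_Ioo]
  filter_upwards [hleb] with x hx hxmem
  obtain ⟨C, hC, hP⟩ := exists_poissonKernel_le hxmem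
  have hone : Tendsto (fun r : ℝ => 1 - r) (𝓝[<] 1) (𝓝[>] 0) := by
    refine tendsto_nhdsWithin_iff.2 ⟨?_, ?_⟩
    · have : Continuous fun r : ℝ => 1 - r := by fun_prop
      simpa using (this.tendsto 1).mono_left nhdsWithin_le_nhds
    · filter_upwards [self_mem_nhdsWithin] with r hr
      simpa using hr
  have hlim := ENNReal.Tendsto.const_mul (a := (ENNReal.ofReal (2 * Real.pi))⁻¹ * ENNReal.ofReal C)
    (hx.comp hone) (Or.inr (ENNReal.mul_ne_top hctop ENNReal.ofReal_ne_top))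
  rw [mul_zero] at hlim
  rw [tendsto_iff_edist_tendsto_0]
  refine tendsto_of_tendsto_of_tendsto_of_le_of_le' tendsto_const_nhds hlim
    (Eventually.of_forall fun _ => zero_le) ?_
  filter_upwards [Ioo_mem_nhdsLT (zero_lt_one' ℝ)] with r hr
  have hw : ‖circleMap 0 r x‖ < 1 := by simpa [abs_of_pos hr.1] using hr.2
  rw [edist_eq_enorm_sub, ← circleMap_zero_eq]
  refine (enorm_extend_taylorSum_sub_le a (G x) hw).trans ?_
  rw [lintegral_angleMeasure, mul_assoc]
  gcongr
  rw [Function.comp_apply, ← lintegral_const_mul' _ _ ENNReal.ofReal_ne_top]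
  refine setLIntegral_mono' measurableSet_Ioc fun t ht => ?_
  rw [Set.indicator_of_mem ht, Set.indicator_of_mem (Set.Ioo_subset_Ioc_self hxmem), ← mul_assoc,
    ← ENNReal.ofReal_mul hC.le]
  gcongr
  exact hP r ⟨hr.1.le, hr.2⟩ t (Set.Ioc_subset_Icc_self ht)

/-! ### Littlewood subordination. -/

theorem eLpNorm_two_sq (f : ℝ → ℂ) :
    eLpNorm f 2 angleMeasure ^ 2 = ∫⁻ θ, ‖f θ‖ₑ ^ 2 ∂angleMeasure := by
  have h := eLpNorm_nnreal_pow_eq_lintegral (f := f) (μ := angleMeasure) (p := 2) two_ne_zero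
  simpa only [NNReal.coe_ofNat, ENNReal.rpow_ofNat, ENNReal.coe_ofNat] using h

/-- Cauchy–Schwarz against the constant `1` for the measure with density the Poisson kernel, which
has total mass one. -/
theorem enorm_extend_taylorSum_sq_le (a : Coeffs) {w : ℂ} (hw : ‖w‖ < 1) :
    ‖extend (taylorSum a) w‖ₑ ^ 2 ≤ ∫⁻ θ, ENNReal.ofReal (poissonKernel 0 w (circleMap 0 1 θ)) *
      ‖fourierIsometry a θ‖ₑ ^ 2 ∂angleMeasure := by
  set P : ℝ → ℝ≥0∞ := fun θ => ENNReal.ofReal (poissonKernel 0 w (circleMap 0 1 θ)) with hPdef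
  have hP : Measurable P := (continuous_poissonKernel_circleMap hw).measurable.ennreal_ofReal
  have hG : Measurable fun θ => ‖fourierIsometry a θ‖ₑ :=
    (Lp.stronglyMeasurable (fourierIsometry a)).measurable.enorm
  have h1 := enorm_extend_taylorSum_sub_le a 0 hw
  simp only [sub_zero] at h1
  have hmass : ∫⁻ θ, 1 ∂(angleMeasure.withDensity P) = 1 := by
    rw [lintegral_withDensity_eq_lintegral_mul _ hP measurable_const]
    simpa [P] using lintegral_poissonKernel hw
  have h2 := ENNReal.lintegral_mul_le_Lp_mul_Lq (angleMeasure.withDensity P)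
    Real.HolderConjugate.two_two (f := fun _ => 1) aemeasurable_const hG.aemeasurable
  simp only [Pi.mul_def, one_mul, ENNReal.one_rpow, hmass] at h2
  rw [lintegral_withDensity_eq_lintegral_mul _ hP hG,
    lintegral_withDensity_eq_lintegral_mul _ hP (hG.pow_const _)] at h2
  refine (pow_le_pow_left₀ zero_le (h1.trans h2) 2).trans ?_
  rw [← ENNReal.rpow_natCast, ← ENNReal.rpow_mul]
  simp [P]

theorem norm_extend_coe_lt_one (φ : UnitDisc → UnitDisc) (z : ℂ) :
    ‖extend (fun z => (φ z : ℂ)) z‖ < 1 := by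
  by_cases hz : ‖z‖ < 1
  · simpa [extend, hz] using (φ (UnitDisc.mk z hz)).norm_lt_one
  · simp [extend, hz]

theorem extend_comp (f : UnitDisc → ℂ) (φ : UnitDisc → UnitDisc) {z : ℂ} (hz : ‖z‖ < 1) :
    extend (fun z => f (φ z)) z = extend f (extend (fun z => (φ z : ℂ)) z) := by
  have h : extend (fun z => (φ z : ℂ)) z = φ (UnitDisc.mk z hz) := by simp [extend, hz]
  rw [h, extend_coe]
  simp [extend, hz]

theorem IsHolomorphic.comp {f : UnitDisc → ℂ} (hf : IsHolomorphic f) {φ : UnitDisc → UnitDisc}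
    (hφ : IsHolomorphic fun z => (φ z : ℂ)) : IsHolomorphic fun z => f (φ z) := by
  refine (DifferentiableOn.comp hf hφ fun z _ =>
    mem_ball_zero_iff.2 (norm_extend_coe_lt_one φ z)).congr fun z hz => ?_
  exact extend_comp f φ (mem_ball_zero_iff.1 hz)

theorem IsHolomorphic.mul {f g : UnitDisc → ℂ} (hf : IsHolomorphic f) (hg : IsHolomorphic g) :
    IsHolomorphic fun z => f z * g z := by
  refine (DifferentiableOn.mul hf hg).congr fun z hz => ?_
  simp [extend, mem_ball_zero_iff.1 hz]

/-- The mean value property of `z ↦ P (φ z, e^{it})`. -/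
theorem integral_poissonKernel_comp {φ : UnitDisc → UnitDisc}
    (hφ : IsHolomorphic fun z => (φ z : ℂ)) {r : ℝ} (hr : r ∈ Set.Ico (0 : ℝ) 1) (t : ℝ) :
    ∫ θ, poissonKernel 0 (extend (fun z => (φ z : ℂ)) (circleMap 0 r θ)) (circleMap 0 1 t)
      ∂angleMeasure = poissonKernel 0 (φ 0) (circleMap 0 1 t) := by
  set Φ := extend (fun z => (φ z : ℂ)) with hΦ
  have hΦ1 : ∀ z, ‖Φ z‖ < 1 := norm_extend_coe_lt_one φ
  have h0 : Φ 0 = φ 0 := by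
    have := extend_coe (fun z => (φ z : ℂ)) 0
    simpa using this
  -- The Poisson kernel is the real part of the Herglotz–Riesz kernel, which is holomorphic in `w`;
  -- so the mean value property applies to `g`.
  set g : ℂ → ℂ := fun z => herglotzRieszKernel 0 (Φ z) (circleMap 0 1 t) with hg
  have hdiff : DifferentiableOn ℂ g (Metric.ball 0 1) := by
    simp only [hg, herglotzRieszKernel_def, sub_zero]
    exact (DifferentiableOn.const_add _ hφ).div (DifferentiableOn.const_sub hφ _)
      fun z _ => circleMap_sub_ne_zero (hΦ1 z) t
  have hcl : DiffContOnCl ℂ g (Metric.ball 0 |r|) := by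
    refine DifferentiableOn.diffContOnCl (hdiff.mono ?_)
    refine Metric.closure_ball_subset_closedBall.trans (Metric.closedBall_subset_ball ?_)
    rw [abs_of_nonneg hr.1]; exact hr.2
  have hcont : Continuous fun θ => g (circleMap 0 r θ) := by
    refine hdiff.continuousOn.comp_continuous (continuous_circleMap 0 r) fun θ => ?_
    simpa [abs_of_nonneg hr.1] using hr.2
  have hint : Integrable (fun θ => g (circleMap 0 r θ)) angleMeasure := by
    exact integrable_angleMeasure_iff.2 (hcont.integrableOn_Ioc)
  have hmean := (integral_circleMap_angleMeasure g r).trans hcl.circleAverage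
  simp only [poissonKernel_eq_re_herglotzRieszKernel, Function.comp_apply]
  rw [← h0]
  have hre := integral_re hint
  rw [hmean] at hre
  exact hre

theorem lintegral_poissonKernel_comp {φ : UnitDisc → UnitDisc}
    (hφ : IsHolomorphic fun z => (φ z : ℂ)) {r : ℝ} (hr : r ∈ Set.Ico (0 : ℝ) 1) (t : ℝ) :
    ∫⁻ θ, ENNReal.ofReal
      (poissonKernel 0 (extend (fun z => (φ z : ℂ)) (circleMap 0 r θ)) (circleMap 0 1 t))
      ∂angleMeasure = ENNReal.ofReal (poissonKernel 0 (φ 0) (circleMap 0 1 t)) := by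
  rw [← integral_poissonKernel_comp hφ hr t, ofReal_integral_eq_lintegral_ofReal]
  -- Without integrability the Bochner integral would be `0`, but it equals a positive value of the
  -- Poisson kernel.
  · by_contra h
    have h1 := integral_poissonKernel_comp hφ hr t
    rw [integral_undef h, poissonKernel_circleMap] at h1
    have h2 : ‖(φ 0 : ℂ)‖ < 1 := (φ 0).norm_lt_one
    have h3 : 0 < 1 - ‖(φ 0 : ℂ)‖ ^ 2 :=
      sub_pos.2 (pow_lt_one₀ (norm_nonneg _) h2 two_ne_zero)
    have h4 := norm_pos_iff.2 (circleMap_sub_ne_zero h2 t)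
    exact absurd h1 (by positivity)
  · exact Eventually.of_forall fun θ =>
      poissonKernel_circleMap_nonneg (norm_extend_coe_lt_one φ _) t

/-- Littlewood's subordination theorem. -/
theorem exists_hardyENorm_comp_le {φ : UnitDisc → UnitDisc}
    (hφ : IsHolomorphic fun z => (φ z : ℂ)) :
    ∃ C : ℝ, 0 ≤ C ∧ ∀ a : Coeffs,
      hardyENorm (fun z => taylorSum a (φ z)) ≤ ENNReal.ofReal (C * ‖a‖) := by
  have hφ0 : ‖(φ 0 : ℂ)‖ < 1 := (φ 0).norm_lt_one
  set κ := (1 + ‖(φ 0 : ℂ)‖) / (1 - ‖(φ 0 : ℂ)‖) with hκ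
  have hκ0 : 0 ≤ κ := div_nonneg (by positivity) (sub_nonneg.2 hφ0.le)
  -- `κ` bounds the Poisson kernel at `φ 0`, which is what remains after Tonelli and averaging over
  -- `θ`; the estimate is for squares, hence the root.
  refine ⟨√κ, Real.sqrt_nonneg _, fun a => iSup₂_le fun r hr => ?_⟩
  set Φ := extend (fun z => (φ z : ℂ)) with hΦ
  set G := fourierIsometry a with hG
  have hGm : Measurable fun t => ‖G t‖ₑ := (Lp.stronglyMeasurable G).measurable.enorm
  have hΦ1 : ∀ z, ‖Φ z‖ < 1 := norm_extend_coe_lt_one φ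
  have hΦm : Measurable fun θ => Φ (circleMap 0 r θ) := (hφ.continuous_circle hr).measurable
  have hnorm : ∀ θ, ‖circleMap 0 r θ‖ < 1 := fun θ => by simpa [abs_of_nonneg hr.1] using hr.2
  have hcm : Measurable fun t => circleMap 0 1 t := (continuous_circleMap 0 1).measurable
  have hGsq : ∫⁻ t, ‖G t‖ₑ ^ 2 ∂angleMeasure = ENNReal.ofReal ‖a‖ ^ 2 := by
    rw [← eLpNorm_two_sq, ← fourierIsometry.norm_map a, Lp.norm_def,
      ENNReal.ofReal_toReal (Lp.eLpNorm_ne_top _)]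
  refine (ENNReal.pow_le_pow_left_iff two_ne_zero).1 ?_
  rw [eLpNorm_two_sq]
  calc ∫⁻ θ, ‖extend (fun z => taylorSum a (φ z)) (circleMap 0 r θ)‖ₑ ^ 2 ∂angleMeasure
      ≤ ∫⁻ θ, ∫⁻ t, ENNReal.ofReal (poissonKernel 0 (Φ (circleMap 0 r θ)) (circleMap 0 1 t)) *
          ‖G t‖ₑ ^ 2 ∂angleMeasure ∂angleMeasure := by
        refine lintegral_mono fun θ => ?_
        rw [extend_comp _ _ (hnorm θ)]
        exact enorm_extend_taylorSum_sq_le a (hΦ1 _)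
    _ = ∫⁻ t, ∫⁻ θ, ENNReal.ofReal (poissonKernel 0 (Φ (circleMap 0 r θ)) (circleMap 0 1 t)) *
          ‖G t‖ₑ ^ 2 ∂angleMeasure ∂angleMeasure := by
        refine lintegral_lintegral_swap (Measurable.aemeasurable ?_)
        simp only [Function.uncurry_def, poissonKernel_circleMap]
        have hw : Measurable fun p : ℝ × ℝ => Φ (circleMap 0 r p.1) := hΦm.comp measurable_fst
        exact ((((hw.norm.pow_const 2).const_sub 1).div
          (((hcm.comp measurable_snd).sub hw).norm.pow_const 2)).ennreal_ofReal).mul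
          ((hGm.comp measurable_snd).pow_const 2)
    _ = ∫⁻ t, ENNReal.ofReal (poissonKernel 0 (φ 0) (circleMap 0 1 t)) * ‖G t‖ₑ ^ 2
          ∂angleMeasure := by
        refine lintegral_congr fun t => ?_
        rw [lintegral_mul_const' _ _ (by simp), lintegral_poissonKernel_comp hφ hr]
    _ ≤ ∫⁻ t, ENNReal.ofReal κ * ‖G t‖ₑ ^ 2 ∂angleMeasure := by
        refine lintegral_mono fun t => ?_
        gcongr
        exact poissonKernel_circleMap_le hφ0 t
    _ = ENNReal.ofReal (√κ * ‖a‖) ^ 2 := by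
        rw [lintegral_const_mul _ (hGm.pow_const 2), hGsq, ← ENNReal.ofReal_pow (norm_nonneg _),
          ← ENNReal.ofReal_mul hκ0, ← ENNReal.ofReal_pow (by positivity), mul_pow, Real.sq_sqrt hκ0]

/-! ### The splitting estimate for weighted composition. -/

theorem extend_mul (f g : UnitDisc → ℂ) (w : ℂ) :
    extend (fun z => f z * g z) w = extend f w * extend g w := by
  by_cases hw : ‖w‖ < 1 <;> simp [extend, hw]

theorem hardyENorm_mul_le {f g : UnitDisc → ℂ} {M : ℝ} (hg : ∀ z, ‖g z‖ ≤ M) :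
    hardyENorm (fun z => f z * g z) ≤ ENNReal.ofReal M * hardyENorm f := by
  have hg' : ∀ w, ‖extend g w‖ ≤ M := by
    intro w
    by_cases hw : ‖w‖ < 1
    · simpa [extend, hw] using hg _
    · simpa [extend, hw] using (norm_nonneg _).trans (hg 0)
  refine iSup₂_le fun r hr => ?_
  refine (eLpNorm_le_mul_eLpNorm_of_ae_le_mul (c := M)
    (g := fun θ => extend f (circleMap 0 r θ)) (Eventually.of_forall fun θ => ?_) 2).trans ?_
  · rw [extend_mul, norm_mul, mul_comm]
    gcongr
    exact hg' _
  · gcongr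
    exact eLpNorm_circle_le_hardyENorm f hr

/-- This puts `φ` itself in `H²`, so that it has radial limits almost everywhere. -/
theorem hardyENorm_lt_top_of_bounded {g : UnitDisc → ℂ} {M : ℝ} (hg : ∀ z, ‖g z‖ ≤ M) :
    hardyENorm g < ∞ := by
  have h1 : hardyENorm (fun _ => 1) < ∞ := by
    refine lt_of_le_of_lt (iSup₂_le fun r hr => (?_ : _ ≤ (1 : ℝ≥0∞))) ENNReal.one_lt_top
    refine (eLpNorm_mono (g := fun _ => (1 : ℂ)) fun θ => ?_).trans ?_
    · unfold extend; split_ifs <;> simp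
    · rw [eLpNorm_const _ two_ne_zero (NeZero.ne _)]
      simp
  have h2 := hardyENorm_mul_le (f := fun _ => 1) hg
  simp only [one_mul] at h2
  exact h2.trans_lt (ENNReal.mul_lt_top ENNReal.ofReal_lt_top h1)

/-- Fatou's lemma on each circle. It yields membership in `H²` for limits of functions with
uniformly bounded norm. -/
theorem hardyENorm_le_of_tendsto {F : ℕ → UnitDisc → ℂ} {f : UnitDisc → ℂ} {K : ℝ≥0∞}
    (hF : ∀ n, IsHolomorphic (F n)) (hlim : ∀ z, Tendsto (fun n => F n z) atTop (𝓝 (f z)))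
    (hK : ∀ n, hardyENorm (F n) ≤ K) : hardyENorm f ≤ K := by
  refine iSup₂_le fun r hr => ?_
  refine (Lp.eLpNorm_lim_le_liminf_eLpNorm (fun n => (hF n).aesm_circle hr) _
    (Eventually.of_forall fun θ => ?_)).trans ?_
  · by_cases hw : ‖circleMap 0 r θ‖ < 1
    · simpa only [extend, dif_pos hw] using hlim _
    · simp only [extend, dif_neg hw, tendsto_const_nhds]
  · exact liminf_le_of_frequently_le' (Frequently.of_forall fun n =>
      (eLpNorm_circle_le_hardyENorm (F n) hr).trans (hK n))

theorem eLpNorm_fourierIsometry (a : Coeffs) :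
    eLpNorm (fourierIsometry a) 2 angleMeasure = hardyENorm (taylorSum a) := by
  rw [hardyENorm_taylorSum, ← fourierIsometry.norm_map a, Lp.norm_def,
    ENNReal.ofReal_toReal (Lp.eLpNorm_ne_top _)]

theorem isHolomorphic_weightedComposition {h f : UnitDisc → ℂ} {φ : UnitDisc → UnitDisc}
    (hh : IsHolomorphic h) (hφ : IsHolomorphic fun z => (φ z : ℂ)) (hf : IsHolomorphic f) :
    IsHolomorphic (weightedComposition h φ f) :=
  hh.mul (hf.comp hφ)

/-- The basic estimate, for functions `f` whose image under `W_{h,φ}` is known to be in `H²`. -/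
theorem hardyENorm_weightedComposition_le {φ : UnitDisc → UnitDisc}
    (hφ : IsHolomorphic fun z => (φ z : ℂ)) {h : UnitDisc → ℂ} (hh : IsHolomorphic h)
    (hhfin : hardyENorm h < ∞) {δ c S : ℝ} (hδ : 0 < δ) (hc : 0 ≤ c) (hS : 0 ≤ S)
    (hbd : AEBoundedOn h (contactSet φ δ) c) {f : UnitDisc → ℂ} (hf : IsHolomorphic f)
    (hcomp : hardyENorm (fun z => f (φ z)) < ∞)
    (hfin : hardyENorm (weightedComposition h φ f) < ∞)
    (hfS : ∀ w : ℂ, ‖w‖ < 1 → ‖w‖ < 1 - δ → ‖extend f w‖ ≤ S) :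
    hardyENorm (weightedComposition h φ f) ≤
      ENNReal.ofReal c * hardyENorm (fun z => f (φ z)) + ENNReal.ofReal S * hardyENorm h := by
  obtain ⟨b, hb⟩ := exists_eq_taylorSum (isHolomorphic_weightedComposition hh hφ hf) hfin
  obtain ⟨d, hd⟩ := exists_eq_taylorSum (hf.comp hφ) hcomp
  obtain ⟨k, rfl⟩ := exists_eq_taylorSum hh hhfin
  obtain ⟨u, hu⟩ := exists_eq_taylorSum hφ
    (hardyENorm_lt_top_of_bounded fun z => (φ z).norm_lt_one.le)
  have hpt : ∀ᵐ x ∂angleMeasure, ‖fourierIsometry b x‖ ≤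
      ((fun x => c * ‖fourierIsometry d x‖) + fun x => S * ‖fourierIsometry k x‖) x := by
    filter_upwards [ae_tendsto_radial b, ae_tendsto_radial d, ae_tendsto_radial k,
      ae_tendsto_radial u, hbd] with x hxb hxd hxk hxu hx
    have hprod : fourierIsometry b x = fourierIsometry k x * fourierIsometry d x := by
      refine tendsto_nhds_unique hxb ((hxk.mul hxd).congr fun r => ?_)
      rw [← hb, ← hd, ← extend_mul]
      rfl
    rw [hprod, norm_mul, Pi.add_apply]
    by_cases hmem : circleMap 0 1 x ∈ contactSet φ δ
    · have h1 := hx hmem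
      rw [boundaryValue, hxk.limUnder_eq] at h1
      have h2 : ‖fourierIsometry k x‖ * ‖fourierIsometry d x‖ ≤ c * ‖fourierIsometry d x‖ := by
        gcongr
      have h3 : 0 ≤ S * ‖fourierIsometry k x‖ := by positivity
      linarith
    · have h1 : ‖fourierIsometry u x‖ < 1 - δ := by
        by_contra! hcon
        refine hmem ⟨by simp, ?_⟩
        rw [boundaryValue, hu, hxu.limUnder_eq]
        exact hcon
      have h1' : ‖fourierIsometry u x‖ < 1 := by linarith
      have hcont : ContinuousAt (extend f) (fourierIsometry u x) :=
        hf.continuousOn.continuousAt (Metric.isOpen_ball.mem_nhds (mem_ball_zero_iff.2 h1'))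
      -- The limit of `φ` lies inside the disc here, so continuity of `f` identifies the radial
      -- limit of `f ∘ φ`.
      have hd' : fourierIsometry d x = extend f (fourierIsometry u x) := by
        refine tendsto_nhds_unique hxd ((hcont.tendsto.comp hxu).congr' ?_)
        filter_upwards [Ioo_mem_nhdsLT (zero_lt_one' ℝ)] with r hr
        rw [← hd, Function.comp_apply, ← hu, ← extend_comp]
        simpa [abs_of_pos hr.1] using hr.2
      have h2 : ‖fourierIsometry d x‖ ≤ S := hd' ▸ hfS _ h1' h1
      have h3 : ‖fourierIsometry k x‖ * ‖fourierIsometry d x‖ ≤ ‖fourierIsometry k x‖ * S := by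
        gcongr
      have h4 : 0 ≤ c * ‖fourierIsometry d x‖ := by positivity
      linarith
  rw [hb, hd, ← eLpNorm_fourierIsometry, ← eLpNorm_fourierIsometry, ← eLpNorm_fourierIsometry]
  have hscale : ∀ (e : ℝ) (he : 0 ≤ e) (a : Coeffs),
      eLpNorm (fun x => e * ‖fourierIsometry a x‖) 2 angleMeasure =
        ENNReal.ofReal e * eLpNorm (fourierIsometry a) 2 angleMeasure := by
    intro e he a
    rw [← eLpNorm_norm (fourierIsometry a), ← Real.enorm_of_nonneg he]
    exact eLpNorm_const_smul e (fun x => ‖fourierIsometry a x‖) 2 angleMeasure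
  rw [← hscale c hc, ← hscale S hS]
  refine (eLpNorm_mono_ae_real hpt).trans (eLpNorm_add_le ?_ ?_ one_le_two)
  · exact ((Lp.aestronglyMeasurable _).norm.const_mul c)
  · exact ((Lp.aestronglyMeasurable _).norm.const_mul S)

/-! ### Truncated power series -/

/-- The truncation of a sequence of coefficients. -/
noncomputable def truncate (N : ℕ) (a : Coeffs) : Coeffs :=
  ∑ n ∈ Finset.range N, lp.single 2 n (a n)

theorem truncate_apply (N : ℕ) (a : Coeffs) (n : ℕ) :
    truncate N a n = if n < N then a n else 0 := by
  rw [truncate, lp.coeFn_sum, Finset.sum_apply]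
  simp only [lp.single_apply, Pi.single_apply]
  simp

theorem norm_le_norm_of_coeff_le {a b : Coeffs} (h : ∀ n, ‖a n‖ ≤ ‖b n‖) : ‖a‖ ≤ ‖b‖ := by
  refine (sq_le_sq₀ (norm_nonneg _) (norm_nonneg _)).1 ?_
  refine hasSum_le (fun n => ?_) (norm_sq_eq_tsum a) (norm_sq_eq_tsum b)
  gcongr
  exact h n

theorem norm_truncate_le (N : ℕ) (a : Coeffs) : ‖truncate N a‖ ≤ ‖a‖ :=
  norm_le_norm_of_coeff_le fun n => by rw [truncate_apply]; split_ifs <;> simp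

theorem norm_sub_truncate_le (N : ℕ) (a : Coeffs) : ‖a - truncate N a‖ ≤ ‖a‖ :=
  norm_le_norm_of_coeff_le fun n => by
    rw [lp.coeFn_sub, Pi.sub_apply, truncate_apply]; split_ifs <;> simp

theorem taylorSum_truncate (N : ℕ) (a : Coeffs) (z : UnitDisc) :
    taylorSum (truncate N a) z = ∑ n ∈ Finset.range N, a n * (z : ℂ) ^ n := by
  rw [taylorSum, tsum_eq_sum (s := Finset.range N)]
  · refine Finset.sum_congr rfl fun n hn => ?_
    rw [truncate_apply, if_pos (Finset.mem_range.1 hn)]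
  · intro n hn
    rw [truncate_apply, if_neg (by simpa using hn), zero_mul]

theorem tendsto_taylorSum_truncate (a : Coeffs) (z : UnitDisc) :
    Tendsto (fun N => taylorSum (truncate N a) z) atTop (𝓝 (taylorSum a z)) := by
  simp only [taylorSum_truncate]
  exact (summable_coeff_mul_pow a z.norm_lt_one).hasSum.tendsto_sum_nat

theorem norm_taylorSum_truncate_le (N : ℕ) (a : Coeffs) (z : UnitDisc) :
    ‖taylorSum (truncate N a) z‖ ≤ ∑ n ∈ Finset.range N, ‖a n‖ := by
  rw [taylorSum_truncate]
  refine norm_sum_le_of_le _ fun n _ => ?_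
  rw [norm_mul, norm_pow]
  exact mul_le_of_le_one_right (norm_nonneg _) (pow_le_one₀ (norm_nonneg _) z.norm_lt_one.le)

/-- Each coefficient is at most `‖a‖`, and what remains is a geometric tail. -/
theorem norm_extend_taylorSum_le {a : Coeffs} {N : ℕ} (ha : ∀ n < N, a n = 0) {ρ : ℝ} (hρ : ρ < 1)
    {w : ℂ} (hw : ‖w‖ ≤ ρ) : ‖extend (taylorSum a) w‖ ≤ ‖a‖ * (ρ ^ N / (1 - ρ)) := by
  have hρ0 : 0 ≤ ρ := (norm_nonneg w).trans hw
  have h1 := (hasSum_nat_add_iff' N).2 (hasSum_taylorSum a (hw.trans_lt hρ))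
  rw [Finset.sum_eq_zero (fun n hn => by rw [ha n (Finset.mem_range.1 hn), zero_mul]),
    sub_zero] at h1
  have h2 := (hasSum_geometric_of_lt_one hρ0 hρ).mul_left (‖a‖ * ρ ^ N)
  rw [div_eq_mul_inv, ← mul_assoc]
  refine h1.norm_le_of_bounded h2 fun n => ?_
  rw [norm_mul, norm_pow, mul_assoc, ← pow_add, add_comm N n]
  gcongr
  exact norm_coeff_le a _

/-- The norm estimate for `W_{h,φ}` on functions with a zero of order `N` at the origin. -/
theorem hardyENorm_weightedComposition_taylorSum_le {φ : UnitDisc → UnitDisc}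
    (hφ : IsHolomorphic fun z => (φ z : ℂ)) (h : HardyTwo) {C : ℝ} (hC : 0 ≤ C)
    (hcomp : ∀ a : Coeffs, hardyENorm (fun z => taylorSum a (φ z)) ≤ ENNReal.ofReal (C * ‖a‖))
    {δ c ρ : ℝ} (hδ : 0 < δ) (hc : 0 ≤ c) (hρ0 : 0 ≤ ρ) (hρ : ρ < 1) (hδρ : 1 - δ ≤ ρ)
    (hbd : AEBoundedOn h (contactSet φ δ) c) {N : ℕ} {a : Coeffs} (ha : ∀ n < N, a n = 0) :
    hardyENorm (weightedComposition h φ (taylorSum a)) ≤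
      ENNReal.ofReal ((c * C + ρ ^ N / (1 - ρ) * ‖h‖) * ‖a‖) := by
  have hρ1 : 0 < 1 - ρ := sub_pos.2 hρ
  -- Polynomials are bounded on the disc, so their images lie in `H²` as the splitting estimate
  -- demands; the bound obtained does not depend on `M`.
  refine hardyENorm_le_of_tendsto (F := fun M => weightedComposition h φ (taylorSum (truncate M a)))
    (fun M => isHolomorphic_weightedComposition h.2.1 hφ (isHolomorphic_taylorSum _))
    (fun z => (tendsto_taylorSum_truncate a (φ z)).const_mul _) fun M => ?_
  have ht : ∀ n < N, truncate M a n = 0 := fun n hn => by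
    rw [truncate_apply, ha n hn, ite_self]
  have hle := norm_truncate_le M a
  refine (hardyENorm_weightedComposition_le (S := ‖truncate M a‖ * (ρ ^ N / (1 - ρ))) hφ h.2.1 h.2.2
    hδ hc (by positivity) hbd (isHolomorphic_taylorSum _)
    ((hcomp _).trans_lt ENNReal.ofReal_lt_top) ?_ fun w _ hw =>
      norm_extend_taylorSum_le ht hρ (hw.le.trans hδρ)).trans ?_
  · exact (hardyENorm_mul_le fun z => norm_taylorSum_truncate_le M a (φ z)).trans_lt
      (ENNReal.mul_lt_top ENNReal.ofReal_lt_top h.2.2)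
  · have hnorm : hardyENorm h = ENNReal.ofReal ‖h‖ := (ENNReal.ofReal_toReal h.2.2.ne).symm
    rw [hnorm]
    calc _ ≤ ENNReal.ofReal c * ENNReal.ofReal (C * ‖a‖) +
          ENNReal.ofReal (‖a‖ * (ρ ^ N / (1 - ρ))) * ENNReal.ofReal ‖h‖ := by
          gcongr
          exact (hcomp _).trans (ENNReal.ofReal_le_ofReal (by gcongr))
      _ = _ := by
          rw [← ENNReal.ofReal_mul hc, ← ENNReal.ofReal_mul (by positivity),
            ← ENNReal.ofReal_add (by positivity) (by positivity)]
          congr 1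
          ring

/-! ### Boundedness and compactness. -/

theorem weightedComposition_add (h : UnitDisc → ℂ) (φ : UnitDisc → UnitDisc) (f g : UnitDisc → ℂ) :
    weightedComposition h φ (f + g) = weightedComposition h φ f + weightedComposition h φ g := by
  funext z; simp [weightedComposition, mul_add]

theorem weightedComposition_smul (h : UnitDisc → ℂ) (φ : UnitDisc → UnitDisc) (c : ℂ)
    (f : UnitDisc → ℂ) :
    weightedComposition h φ (c • f) = c • weightedComposition h φ f := by
  funext z; simp [weightedComposition, mul_left_comm]

theorem isBoundedOnHardyTwo_of_le {φ : UnitDisc → UnitDisc}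
    (hφ : IsHolomorphic fun z => (φ z : ℂ)) {h : HardyTwo} {K : ℝ} (hK0 : 0 ≤ K)
    (hK : ∀ a : Coeffs,
      hardyENorm (weightedComposition h φ (taylorSum a)) ≤ ENNReal.ofReal (K * ‖a‖)) :
    IsBoundedOnHardyTwo h φ := by
  have hK' : ∀ f : HardyTwo, hardyENorm (weightedComposition h φ f) ≤ ENNReal.ofReal (K * ‖f‖) := by
    intro f
    have := hK (HardyTwo.ofCoeffs.symm f)
    rwa [← HardyTwo.coe_ofCoeffs, LinearIsometryEquiv.apply_symm_apply,
      LinearIsometryEquiv.norm_map] at this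
  refine ⟨LinearMap.mkContinuous
    { toFun := fun f => ⟨weightedComposition h φ f,
        isHolomorphic_weightedComposition h.2.1 hφ f.2.1,
        (hK' f).trans_lt ENNReal.ofReal_lt_top⟩
      map_add' := fun f g => Subtype.ext (weightedComposition_add h φ f g)
      map_smul' := fun c f => Subtype.ext (weightedComposition_smul h φ c f) } K fun f => ?_,
    fun f => rfl⟩
  exact ENNReal.toReal_le_of_le_ofReal (by positivity) (hK' f)

/-- The composition is a finite sum of maps `a ↦ a n • T eₙ`, each factoring through `ℂ`. -/
theorem isCompactOperator_comp_truncate (T : Coeffs →L[ℂ] HardyTwo) (N : ℕ) :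
    ∃ F : Coeffs →L[ℂ] HardyTwo, (∀ a, F a = T (truncate N a)) ∧ IsCompactOperator F := by
  refine ⟨∑ n ∈ Finset.range N,
    (lp.evalCLM ℂ (fun _ : ℕ => ℂ) 2 n).smulRight (T (lp.single 2 n 1)), fun a => ?_, ?_⟩
  · rw [truncate, map_sum, sum_apply]
    refine Finset.sum_congr rfl fun n _ => ?_
    rw [ContinuousLinearMap.smulRight_apply, ← map_smul, ← lp.single_smul, smul_eq_mul, mul_one]
    rfl
  · refine (compactOperator (RingHom.id ℂ) Coeffs HardyTwo).sum_mem fun n _ => ?_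
    have h1 : IsCompactOperator (ContinuousLinearMap.toSpanSingleton ℂ (T (lp.single 2 n 1))) :=
      isCompactOperator_of_locallyCompactSpace_rng
        (ContinuousLinearMap.toSpanSingleton ℂ (T (lp.single 2 n 1)))
    exact h1.comp_clm (lp.evalCLM ℂ (fun _ : ℕ => ℂ) 2 n)

theorem AEBoundedOn.isBoundedOnHardyTwo {φ : UnitDisc → UnitDisc}
    (hφ : IsHolomorphic fun z => (φ z : ℂ)) {h : HardyTwo} {δ c : ℝ} (hδ : 0 < δ) (hc : 0 ≤ c)
    (hbd : AEBoundedOn h (contactSet φ δ) c) : IsBoundedOnHardyTwo h φ := by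
  obtain ⟨C, hC, hcomp⟩ := exists_hardyENorm_comp_le hφ
  -- The maximum with `0` covers `δ > 1`. With `N = 0` below, no coefficient has to vanish.
  have hρ : max (1 - δ) 0 < 1 := max_lt (by linarith) one_pos
  have hρ1 : 0 < 1 - max (1 - δ) 0 := sub_pos.2 hρ
  refine isBoundedOnHardyTwo_of_le hφ (K := c * C + max (1 - δ) 0 ^ 0 / (1 - max (1 - δ) 0) * ‖h‖)
    (by positivity) fun a => ?_
  exact hardyENorm_weightedComposition_taylorSum_le hφ h hC hcomp hδ hc (le_max_right _ _) hρ
    (le_max_left _ _) hbd (N := 0) (by simp)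

theorem isCompactOnHardyTwo_of_tendsto {φ : UnitDisc → UnitDisc}
    (hφ : IsHolomorphic fun z => (φ z : ℂ)) {h : HardyTwo} {c : ℝ → ℝ}
    (hbd : ∀ᶠ δ in 𝓝[>] (0 : ℝ), 0 < c δ ∧ AEBoundedOn h (contactSet φ δ) (c δ))
    (hlim : Tendsto c (𝓝[>] (0 : ℝ)) (𝓝 0)) : IsCompactOnHardyTwo h φ := by
  obtain ⟨C, hC, hcomp⟩ := exists_hardyENorm_comp_le hφ
  obtain ⟨δ₀, ⟨hc₀, hbd₀⟩, hδ₀⟩ := (hbd.and self_mem_nhdsWithin).exists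
  obtain ⟨T, hT⟩ := hbd₀.isBoundedOnHardyTwo hφ hδ₀ hc₀.le
  refine ⟨T, hT, ?_⟩
  set U : Coeffs →L[ℂ] HardyTwo := 
    T.comp (HardyTwo.ofCoeffs.toContinuousLinearEquiv : Coeffs →L[ℂ] HardyTwo) with hU
  choose F hF hFc using isCompactOperator_comp_truncate U
  have hFlim : Tendsto F atTop (𝓝 U) := by
    rw [tendsto_iff_norm_sub_tendsto_zero]
    refine tendsto_order.2 ⟨fun ε hε => Eventually.of_forall fun N => hε.trans_le (norm_nonneg _),
      fun ε' hε' => ?_⟩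
    -- The operator norm bound is not strict, so a smaller `ε` leaves room. Then `δ` is fixed before
    -- `N`, each contributing `ε / 2`.
    obtain ⟨ε, hε, hεε'⟩ := exists_between hε'
    have hcC : Tendsto (fun δ => c δ * C) (𝓝[>] 0) (𝓝 0) := by simpa using hlim.mul_const C
    obtain ⟨δ, ⟨⟨hcδ, hbdδ⟩, hδ0, hδ1⟩, hcε⟩ :=
      ((hbd.and (Ioo_mem_nhdsGT (zero_lt_one' ℝ))).and
        (hcC.eventually_le_const (half_pos hε))).exists
    have hρ0 : 0 ≤ 1 - δ := sub_nonneg.2 hδ1.le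
    have hρ1 : 1 - δ < 1 := by linarith
    have hpow : Tendsto (fun N : ℕ => (1 - δ) ^ N / (1 - (1 - δ)) * ‖h‖) atTop (𝓝 0) := by
      simpa using ((tendsto_pow_atTop_nhds_zero_of_lt_one hρ0 hρ1).div_const
        (1 - (1 - δ))).mul_const ‖h‖
    filter_upwards [hpow.eventually_le_const (half_pos hε)] with N hN
    refine lt_of_le_of_lt ?_ hεε'
    refine ContinuousLinearMap.opNorm_le_bound _ hε.le fun a => ?_
    -- The error is `U` on the tail, whose first `N` coefficients vanish and whose norm is at most
    -- `‖a‖`.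
    have hsub : F N a - U a = -U (a - truncate N a) := by
      rw [hF, map_sub, neg_sub]
    rw [sub_apply, hsub, norm_neg]
    have hle := hardyENorm_weightedComposition_taylorSum_le hφ h hC hcomp hδ0 hcδ.le hρ0 hρ1 le_rfl
      hbdδ (N := N) (a := a - truncate N a) fun n hn => by
        rw [lp.coeFn_sub, Pi.sub_apply, truncate_apply, if_pos hn, sub_self]
    have hUa : (U (a - truncate N a) : UnitDisc → ℂ) =
        weightedComposition h φ (taylorSum (a - truncate N a)) := hT _
    rw [← hUa] at hle
    have hK0 : 0 ≤ c δ * C + (1 - δ) ^ N / (1 - (1 - δ)) * ‖h‖ := by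
      have : 0 ≤ 1 - (1 - δ) := by linarith
      positivity
    refine (ENNReal.toReal_le_of_le_ofReal (by positivity) hle).trans ?_
    refine mul_le_mul (by linarith) (norm_sub_truncate_le N a) (norm_nonneg _) hε.le
  have hUc : IsCompactOperator U := isCompactOperator_of_tendsto hFlim (Eventually.of_forall hFc)
  have hTU : (T : HardyTwo → HardyTwo) = U ∘ HardyTwo.ofCoeffs.symm.toContinuousLinearEquiv := by
    funext f
    simp [hU]
  rw [hTU]
  exact hUc.comp_clm (HardyTwo.ofCoeffs.symm.toContinuousLinearEquiv : HardyTwo →L[ℂ] Coeffs)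

end HardyDisc

theorem mainTheorem2 (φ : UnitDisc → UnitDisc)
    (hφ : HardyDisc.IsHolomorphic (fun z => (φ z : ℂ))) (h : HardyDisc.HardyTwo) :
    (∀ δ c : ℝ, 0 < δ → 0 < c →
      HardyDisc.AEBoundedOn h (HardyDisc.contactSet φ δ) c →
      HardyDisc.IsBoundedOnHardyTwo h φ) ∧
    (∀ c : ℝ → ℝ,
      (∀ᶠ δ in 𝓝[>] (0 : ℝ),
        0 < c δ ∧ HardyDisc.AEBoundedOn h (HardyDisc.contactSet φ δ) (c δ)) →
      Tendsto c (𝓝[>] (0 : ℝ)) (𝓝 0) →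
      HardyDisc.IsCompactOnHardyTwo h φ) := by
  refine ⟨fun δ c hδ hc hbd => hbd.isBoundedOnHardyTwo hφ hδ hc.le, fun c hbd hlim => ?_⟩
  exact HardyDisc.isCompactOnHardyTwo_of_tendsto hφ hbd hlim
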